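/- Let $\Sigma,\Sigma'\subset\mathbb R^d$ be rational convex polyhedra (solution sets of finitely many non-strict linear inequalities with integer coefficients; polytopes are the bounded case). For a polyhedron $P$ let $\mathcal F_P$ be the set of its nonempty faces, $P$ included; for $f\in\mathcal F_P$ the cone $N_P(f)$ of the normal fan of $P$ is the set of linear functionals whose maximum over $P$ is attained at every point of $f$. Assume that $\Sigma'$ is a degeneration of $\Sigma$: there is a deformation $\Sigma(\alpha)$, $\alpha\in[0,1]$, continuous for the Hausdorff distance, with $\Sigma(0)=\Sigma$, $\Sigma(1)=\Sigma'$, such that for $0\le\alpha<1$ the set $\Sigma(\alpha)$ is a polyhedron with the same normal fan as $\Sigma$. Then there is a unique map $\pi:\mathcal F_\Sigma\to\mathcal F_{\Sigma'}$ such that, for every $f$, $N_{\Sigma'}(\pi(f))$ is the minimal cone of the normal fan of $\Sigma'$ that contains $N_\Sigma(f)$, and $\pi$ sends vertices to vertices. Assume moreover that $\pi(v)-v\in\mathbb Z^d$ for every vertex $v$ of $\Sigma$ (for instance, that all vertices of $\Sigma$ and $\Sigma'$ are integral). Let $R$ be a commutative ring. A weight $\varphi:\mathcal F_P\to R$ defines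 the formal Laurent series $S_\varphi(P)=\sum_{a\in P\cap\mathbb Z^d}\varphi(f_a)\,e^a$, where $f_a$ is the minimal face of $P$ containing $a$ and $e^a=x_1^{a_1}\cdots x_d^{a_d}$; if $q$ is a Laurent polynomial over $R$ that is not a zero divisor and $qS_\varphi(P)=p$ is a Laurent polynomial, then $\sigma_\varphi(P)=p/q$ in the total ring of fractions of $R[x_1^{\pm1},\dots,x_d^{\pm1}]$. For a vertex $v$ of $P$ with tangent cone $C_v$, a weight on $\mathcal F_P$ is restricted to $\mathcal F_{C_v}$ along the embedding $\mathcal F_{C_v}\hookrightarrow\mathcal F_P$, $g\mapsto g\cap P$. Let $\varphi:\mathcal F_\Sigma\to R$ be any weight, and define $\varphi':\mathcal F_{\Sigma'}\to R$ by $$\varphi'(f')=\sum_{f\in\pi^{-1}(f')}(-1)^{\dim f-\dim f'}\varphi(f).$$ Then $\sigma_{\varphi'}(\Sigma')$ and all $\sigma_\varphi(C_v)$ are well defined, and $$\sigma_{\varphi'}(\Sigma')=\sum_{v\text{ vertex of }\Sigma}e^{\pi(v)-v}\,\sigma_\varphi(C_v).$$ -/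

import Mathlib

open scoped Topology

noncomputable section

namespace WeightedBrion

/-! ### Polyhedra, faces, normal fans -/

/-- A convex polyhedron in `ℝ^d` (not necessarily bounded): the solution set of finitely many
non-strict linear inequalities with real coefficients. -/
def IsPolyhedron {d : ℕ} (P : Set (Fin d → ℝ)) : Prop :=
  ∃ (m : ℕ) (A : Fin m → Fin d → ℝ) (b : Fin m → ℝ), P = {x | ∀ i, ∑ j, A i j * x j ≤ b i}

/-- A rational convex polyhedron in `ℝ^d` (not necessarily bounded): the solution set of finitely
many non-strict linear inequalities with integer coefficients. -/
def IsRationalPolyhedron {d : ℕ} (P : Set (Fin d → ℝ)) : Prop :=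
  ∃ (m : ℕ) (A : Fin m → Fin d → ℤ) (b : Fin m → ℤ),
    P = {x | ∀ i, ∑ j, (A i j : ℝ) * x j ≤ (b i : ℝ)}

/-- The set of (nonempty) faces of `P`, including `P` itself: the nonempty subsets of `P` on which
some linear functional attains its maximum over `P`. -/
def Face {d : ℕ} (P : Set (Fin d → ℝ)) : Type :=
  {f : Set (Fin d → ℝ) // f.Nonempty ∧ IsExposed ℝ P f}

/-- The dimension of a face (of its affine hull). -/
def Face.dim {d : ℕ} {P : Set (Fin d → ℝ)} (f : Face P) : ℕ :=
  Module.finrank ℝ (vectorSpan ℝ f.1)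

/-- The vertices of `P`: the points `v` such that `{v}` is a face. -/
def Vertex {d : ℕ} (P : Set (Fin d → ℝ)) : Type :=
  {v : Fin d → ℝ // IsExposed ℝ P {v}}

/-- A vertex viewed as a face. -/
def Vertex.face {d : ℕ} {P : Set (Fin d → ℝ)} (v : Vertex P) : Face P :=
  ⟨{v.1}, Set.singleton_nonempty _, v.2⟩

theorem Vertex.mem {d : ℕ} {P : Set (Fin d → ℝ)} (v : Vertex P) : v.1 ∈ P :=
  v.2.subset rfl

/-- The cone of the normal fan of `P` corresponding to the face `f`: the linear functionals whose
maximum over `P` is attained at all points of `f`. -/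
def normalCone {d : ℕ} {P : Set (Fin d → ℝ)} (f : Face P) : Set (StrongDual ℝ (Fin d → ℝ)) :=
  {l | ∀ x ∈ f.1, ∀ y ∈ P, l y ≤ l x}

/-- The normal fan of `P`, as the set of its cones. -/
def normalFan {d : ℕ} (P : Set (Fin d → ℝ)) : Set (Set (StrongDual ℝ (Fin d → ℝ))) :=
  Set.range (normalCone (P := P))

/-- `P` and `Q` are analogous if their normal fans coincide. -/
def Analogous {d : ℕ} (P Q : Set (Fin d → ℝ)) : Prop :=
  normalFan P = normalFan Q

/-! ### Degenerations and the induced map of faces -/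

/-- `Q` is a degeneration of `P`: there is a deformation `S α`, `α ∈ [0, 1]`, continuous for the
Hausdorff distance, with `S 0 = P`, `S 1 = Q` and `S α` a polyhedron analogous to `P` for
`0 ≤ α < 1`. (The Hausdorff distance is the one of the sup norm; it gives the same
notion of continuity as the one of the Euclidean norm.) -/
def IsDegeneration {d : ℕ} (P Q : Set (Fin d → ℝ)) : Prop :=
  ∃ S : ℝ → Set (Fin d → ℝ),
    S 0 = P ∧ S 1 = Q ∧
    (∀ α ∈ Set.Icc (0 : ℝ) 1,
      Filter.Tendsto (fun β => Metric.hausdorffEDist (S β) (S α))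
        (𝓝[Set.Icc (0 : ℝ) 1] α) (𝓝 0)) ∧
    ∀ α ∈ Set.Ico (0 : ℝ) 1, IsPolyhedron (S α) ∧ Analogous P (S α)

/-- `π` is the map of faces induced by a refinement of normal fans: the cone of `π f` is the minimal
cone of the normal fan of `Q` that contains the cone of `f`. -/
def IsInducedFaceMap {d : ℕ} {P Q : Set (Fin d → ℝ)} (π : Face P → Face Q) : Prop :=
  ∀ f, normalCone f ⊆ normalCone (π f) ∧
    ∀ g : Face Q, normalCone f ⊆ normalCone g → normalCone (π f) ⊆ normalCone g

/-- The weight `φ'` on the faces of `Q`: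
`φ' f' = ∑_{f ∈ π⁻¹(f')} (-1)^(dim f - dim f') φ f`. -/
def pushWeight {d : ℕ} {R : Type*} [CommRing R] {P Q : Set (Fin d → ℝ)}
    (π : Face P → Face Q) (φ : Face P → R) : Face Q → R :=
  fun f' => ∑ᶠ (f : Face P) (_ : π f = f'),
    (((-1 : ℤˣ) ^ ((f.dim : ℤ) - (f'.dim : ℤ)) : ℤˣ) : ℤ) • φ f

/-! ### Tangent cones -/

/-- The tangent cone of the polyhedron `P` at its point `v` (with apex `v`). -/
def tangentCone {d : ℕ} (P : Set (Fin d → ℝ)) (v : Fin d → ℝ) : Set (Fin d → ℝ) :=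
  {x | ∃ t : ℝ, 0 ≤ t ∧ ∃ y ∈ P, x = v + t • (y - v)}

theorem subset_tangentCone {d : ℕ} (P : Set (Fin d → ℝ)) (v : Fin d → ℝ) :
    P ⊆ tangentCone P v := fun y hy => ⟨1, zero_le_one, y, hy, by simp⟩

/-- Every face of the tangent cone contains its apex. -/
theorem apex_mem_face {d : ℕ} {P : Set (Fin d → ℝ)} {v : Fin d → ℝ} (hv : v ∈ P)
    (g : Face (tangentCone P v)) : v ∈ g.1 := by
  obtain ⟨l, hl⟩ := g.2.2 g.2.1
  obtain ⟨x, hx⟩ := g.2.1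
  rw [hl] at hx ⊢
  refine ⟨subset_tangentCone P v hv, fun y hy => (hx.2 y hy).trans ?_⟩
  obtain ⟨⟨t, ht, z, hz, rfl⟩, hmax⟩ := hx
  have h := hmax (v + (t + 1) • (z - v)) ⟨t + 1, by linarith, z, hz, rfl⟩
  simp only [map_add, map_smul, smul_eq_mul] at h ⊢
  nlinarith

/-- The natural embedding of the faces of the tangent cone at `v` into the faces of `P`; it sends
`g` to `g ∩ P`. -/
def coneFace {d : ℕ} {P : Set (Fin d → ℝ)} {v : Fin d → ℝ} (hv : v ∈ P)
    (g : Face (tangentCone P v)) : Face P :=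
  ⟨g.1 ∩ P, ⟨v, apex_mem_face hv g, hv⟩, fun _ => by
    obtain ⟨l, hl⟩ := g.2.2 g.2.1
    have hvg := apex_mem_face hv g
    refine ⟨l, ?_⟩
    ext x
    rw [hl] at hvg ⊢
    constructor
    · rintro ⟨⟨_, h⟩, hx⟩
      exact ⟨hx, fun y hy => h y (subset_tangentCone P v hy)⟩
    · rintro ⟨hx, h⟩
      exact ⟨⟨subset_tangentCone P v hx, fun y hy => (hvg.2 y hy).trans (h v hv)⟩, hx⟩⟩

/-! ### Weighted integer point transforms -/

/-- Laurent polynomials in `x_1, …, x_d` over `R`; `single a c` is `c * e^a`. -/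
abbrev Laurent (R : Type*) [CommRing R] (d : ℕ) : Type _ := AddMonoidAlgebra R (Fin d → ℤ)

/-- Rational functions in `x_1, …, x_d` over `R`: the total ring of fractions of the Laurent
polynomial ring (denominators are the elements that are not zero divisors; when `R` is an integral
domain this is the field of rational functions). -/
abbrev RatFun (R : Type*) [CommRing R] (d : ℕ) : Type _ := FractionRing (Laurent R d)

/-- The monomial `e^a = x_1^{a_1} ⋯ x_d^{a_d}` as a rational function. -/
def expMonomial (R : Type*) [CommRing R] {d : ℕ} (a : Fin d → ℤ) : RatFun R d :=
  algebraMap (Laurent R d) (RatFun R d) (AddMonoidAlgebra.single a 1)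

/-- The product of a Laurent polynomial and a formal (two-sided infinite) Laurent series, the
latter given by its coefficients. -/
def seriesMul {d : ℕ} {R : Type*} [CommRing R] (q : Laurent R d) (s : (Fin d → ℤ) → R) :
    (Fin d → ℤ) → R :=
  fun b => q.coeff.sum fun a c => c * s (b - a)

/-- The series `s` represents the rational function `r`: there are Laurent polynomials `q`, not a
zero divisor, and `p` with `q * s = p` as series and `r = p / q`. -/
def HasSumRat {d : ℕ} {R : Type*} [CommRing R] (s : (Fin d → ℤ) → R) (r : RatFun R d) : Prop :=
  ∃ q ∈ nonZeroDivisors (Laurent R d), ∃ p : Laurent R d,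
    (∀ b, seriesMul q s b = p.coeff b) ∧
    r * algebraMap (Laurent R d) (RatFun R d) q = algebraMap (Laurent R d) (RatFun R d) p

theorem seriesMul_comm {d : ℕ} {R : Type*} [CommRing R] (q q' : Laurent R d)
    (s : (Fin d → ℤ) → R) :
    seriesMul q (seriesMul q' s) = seriesMul q' (seriesMul q s) := by
  funext b
  simp only [seriesMul, Finsupp.sum, Finset.mul_sum]
  rw [Finset.sum_comm]
  refine Finset.sum_congr rfl fun a _ => Finset.sum_congr rfl fun a' _ => ?_
  rw [sub_right_comm]
  ring

theorem seriesMul_coeff {d : ℕ} {R : Type*} [CommRing R] (q p : Laurent R d) :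
    seriesMul q p.coeff = (q * p).coeff := by
  classical
  funext b
  induction q using AddMonoidAlgebra.induction_linear with
  | zero => simp [seriesMul]
  | add f g hf hg =>
    rw [add_mul, AddMonoidAlgebra.coeff_add, Finsupp.add_apply, ← hf, ← hg]
    simp only [seriesMul, AddMonoidAlgebra.coeff_add]
    exact Finsupp.sum_add_index' (by simp) (by intros; ring)
  | single a c =>
    simp [seriesMul, AddMonoidAlgebra.coeff_single_mul_apply, sub_eq_neg_add]

/-- The rational function represented by a series is unique. -/
theorem HasSumRat.unique {d : ℕ} {R : Type*} [CommRing R] {s : (Fin d → ℤ) → R}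
    {r r' : RatFun R d} (h : HasSumRat s r) (h' : HasSumRat s r') : r = r' := by
  obtain ⟨q, hq, p, hp, hr⟩ := h
  obtain ⟨q', hq', p', hp', hr'⟩ := h'
  have e : q' * p = q * p' := by
    apply AddMonoidAlgebra.coeff_injective
    apply DFunLike.coe_injective
    rw [← seriesMul_coeff, ← seriesMul_coeff, ← funext hp, ← funext hp', seriesMul_comm]
  have u := IsLocalization.map_units (RatFun R d) (⟨q, hq⟩ : nonZeroDivisors (Laurent R d))
  have u' := IsLocalization.map_units (RatFun R d) (⟨q', hq'⟩ : nonZeroDivisors (Laurent R d))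
  refine (u.mul u').mul_right_cancel ?_
  have e' := congrArg (algebraMap (Laurent R d) (RatFun R d)) e
  rw [map_mul, map_mul, ← hr, ← hr'] at e'
  linear_combination e'

open Classical in
/-- The rational function represented by a series (and `0` if there is none). -/
def sumRat {d : ℕ} {R : Type*} [CommRing R] (s : (Fin d → ℤ) → R) : RatFun R d :=
  if h : ∃ r, HasSumRat s r then h.choose else 0

/-- `f` is the minimal face of `P` containing the point `x`. -/
def IsMinFace {d : ℕ} {P : Set (Fin d → ℝ)} (x : Fin d → ℝ) (f : Face P) : Prop :=
  x ∈ f.1 ∧ ∀ g : Face P, x ∈ g.1 → f.1 ⊆ g.1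

open Classical in
/-- The weighted generating series `S_φ(P)`: the coefficient at an integer point `a` of `P` is the
weight of the minimal face of `P` that contains `a`; it is `0` at the integer points outside `P`. -/
def weightedSeries {d : ℕ} {R : Type*} [CommRing R] (P : Set (Fin d → ℝ)) (φ : Face P → R) :
    (Fin d → ℤ) → R :=
  fun a => if h : ∃ f : Face P, IsMinFace (fun i => (a i : ℝ)) f then φ h.choose else 0

/-- The weighted integer point transform `σ_φ(P)`. -/
def weightedIPT {d : ℕ} {R : Type*} [CommRing R] (P : Set (Fin d → ℝ)) (φ : Face P → R) :
    RatFun R d :=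
  sumRat (weightedSeries P φ)

/-- The restriction of a weight on the faces of `P` to the faces of the tangent cone at `v`. -/
def restrictWeight {d : ℕ} {R : Type*} {P : Set (Fin d → ℝ)} (φ : Face P → R) (v : Vertex P) :
    Face (tangentCone P v.1) → R :=
  fun g => φ (coneFace v.mem g)

end WeightedBrion

end

/-! Möbius inversion over the faces of `P` gives coefficients `μ` with `φ g = ∑ μ f` over all faces
`f ⊇ g` (`exists_sum_superset`), so a weighted series becomes a combination of indicator functions
of closed faces. It then suffices to understand what happens to each single face `f` under the
degeneration.

Two combinatorial facts are needed. First, the signed sum of `(-1)^dim g` over the faces `g ⊆ f`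
with `π g = f'` is `(-1)^dim f'` whenever `f' ⊆ π f` (`IsInducedFaceMap.sum_fiber`). This says
precisely that `pushWeight` turns the indicator of `f` into that of `π f`. Second, a Brianchon-Gram
relation (`IsInducedFaceMap.sum_shiftedCone`) writes the indicator of `π f` as the signed sum of the
indicators of the cones `shiftedCone π f g`, over those faces `g ⊆ f` whose cell lies in the
interior of the support of the normal fan.

Summed over `f`, the terms of a face `g` of positive dimension are invariant under translation by a
nonzero integer vector parallel to `g`. Multiplication by `1 - e^u` kills such a series, so it
represents zero. The terms of a vertex `v` form the weighted series of its tangent cone moved by `π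
v - v`, and these give the right-hand side.

Both combinatorial facts come from one principle in the dual space. The cells of the normal fan,
that is the sets of functionals maximal exactly on a given face, are relatively open cones with `dim
cell f + dim f = d`. They partition the support of the fan, and those of `P` refine those of `Q`.
Any linear relation between indicators of relatively open convex sets remains true after each
indicator is replaced by `(-1)^dim` (`sum_neg_one_pow_finrank_eq_zero`). It is applied to partitions
into cells within a small convex neighbourhood of a functional exposing `f`.

Every weighted series is rational because its coefficients depend only on finitely many truncated
integral linear forms (`isRatSeries_of_clipEquiv`). If `P` has no vertex, `Q` is periodic along an
integer vector and all its series represent zero. -/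

noncomputable section

namespace WeightedBrion

/-! ### Euler relations between relatively open convex sets -/

/-- A convex set in which every segment can be prolonged beyond its end points (in finite dimension
these are the relatively open convex sets). -/
structure IsRelOpenConvex {V : Type*} [AddCommGroup V] [Module ℝ V] (C : Set V) : Prop where
  convex : Convex ℝ C
  prolong : ∀ x ∈ C, ∀ y ∈ C, ∃ ε : ℝ, 0 < ε ∧ x + ε • (x - y) ∈ C

namespace IsRelOpenConvex

variable {V : Type*} [AddCommGroup V] [Module ℝ V] {C D : Set V}

theorem add_smul_mem_of_le (hC : Convex ℝ C) {x v : V} (hx : x ∈ C) {ε δ : ℝ} (hδ : 0 ≤ δ)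
    (h : δ ≤ ε) (hv : x + ε • v ∈ C) : x + δ • v ∈ C := by
  rcases hδ.eq_or_lt with rfl | hδ
  · simpa using hx
  have hε : 0 < ε := hδ.trans_le h
  have := hC.add_smul_sub_mem hx hv (t := δ / ε) ⟨by positivity, by rw [div_le_one hε]; exact h⟩
  rwa [add_sub_cancel_left, smul_smul, div_mul_cancel₀ _ hε.ne'] at this

theorem inter (hC : IsRelOpenConvex C) (hD : IsRelOpenConvex D) : IsRelOpenConvex (C ∩ D) := by
  refine ⟨hC.convex.inter hD.convex, fun x hx y hy => ?_⟩
  obtain ⟨ε, hε, h⟩ := hC.prolong x hx.1 y hy.1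
  obtain ⟨δ, hδ, h'⟩ := hD.prolong x hx.2 y hy.2
  exact ⟨min ε δ, lt_min hε hδ,
    add_smul_mem_of_le hC.convex hx.1 (lt_min hε hδ).le (min_le_left _ _) h,
    add_smul_mem_of_le hD.convex hx.2 (lt_min hε hδ).le (min_le_right _ _) h'⟩

theorem image {W : Type*} [AddCommGroup W] [Module ℝ W] (hC : IsRelOpenConvex C) (f : V →ₗ[ℝ] W) :
    IsRelOpenConvex (f '' C) := by
  refine ⟨hC.convex.linear_image f, ?_⟩
  rintro _ ⟨x, hx, rfl⟩ _ ⟨y, hy, rfl⟩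
  obtain ⟨ε, hε, h⟩ := hC.prolong x hx y hy
  exact ⟨ε, hε, _, h, by simp⟩

theorem hyperplane (f : V →ₗ[ℝ] ℝ) (t : ℝ) : IsRelOpenConvex {x | f x = t} := by
  refine ⟨convex_hyperplane f.isLinear t, fun x hx y hy => ⟨1, one_pos, ?_⟩⟩
  simp only [Set.mem_ofPred_eq] at *
  simp [hx, hy]

theorem of_isOpen {V : Type*} [AddCommGroup V] [Module ℝ V] [TopologicalSpace V]
    [IsTopologicalAddGroup V] [ContinuousSMul ℝ V] {U : Set V} (hU : IsOpen U) (hc : Convex ℝ U) :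
    IsRelOpenConvex U := by
  refine ⟨hc, fun x hx y _ => ?_⟩
  have h : Filter.Tendsto (fun ε : ℝ => x + ε • (x - y)) (𝓝[>] 0) (𝓝 x) := by
    have : Continuous fun ε : ℝ => x + ε • (x - y) := by fun_prop
    simpa using (this.tendsto 0).mono_left nhdsWithin_le_nhds
  obtain ⟨ε, h1, h2⟩ := ((h.eventually (hU.mem_nhds hx)).and self_mem_nhdsWithin).exists
  exact ⟨ε, h2, h1⟩

/-- The directions in which one can move from `x` inside `C` form a subspace: `prolong` gives
negatives, and midpoints give sums. -/
theorem exists_add_smul_mem (hC : IsRelOpenConvex C) {x v : V} (hx : x ∈ C)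
    (hv : v ∈ vectorSpan ℝ C) : ∃ ε : ℝ, 0 < ε ∧ x + ε • v ∈ C := by
  rw [vectorSpan_eq_span_vsub_set_right ℝ hx] at hv
  have neg : ∀ v, (∃ ε : ℝ, 0 < ε ∧ x + ε • v ∈ C) → ∃ ε : ℝ, 0 < ε ∧ x + ε • (-v) ∈ C := by
    rintro v ⟨ε, hε, h⟩
    obtain ⟨δ, hδ, h'⟩ := hC.prolong x hx _ h
    refine ⟨δ * ε, by positivity, ?_⟩
    convert h' using 2
    module
  have pos : ∀ v, (∃ ε : ℝ, 0 < ε ∧ x + ε • v ∈ C) → ∀ c : ℝ, 0 < c →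
      ∃ ε : ℝ, 0 < ε ∧ x + ε • (c • v) ∈ C := by
    rintro v ⟨ε, hε, h⟩ c hc
    refine ⟨ε / c, by positivity, ?_⟩
    rwa [smul_smul, div_mul_cancel₀ _ hc.ne']
  induction hv using Submodule.span_induction with
  | mem v hv =>
    obtain ⟨y, hy, rfl⟩ := hv
    exact ⟨1, one_pos, by simpa using hy⟩
  | zero => exact ⟨1, one_pos, by simpa using hx⟩
  | add v w _ _ hv hw =>
    obtain ⟨ε, hε, h⟩ := hv
    obtain ⟨δ, hδ, h'⟩ := hw
    have hm := lt_min hε hδ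
    have h1 := add_smul_mem_of_le hC.convex hx hm.le (min_le_left _ _) h
    have h2 := add_smul_mem_of_le hC.convex hx hm.le (min_le_right _ _) h'
    refine ⟨min ε δ / 2, by positivity, ?_⟩
    convert hC.convex h1 h2 (a := 1 / 2) (b := 1 / 2) (by norm_num) (by norm_num) (by norm_num)
      using 1
    module
  | smul c v _ hv =>
    rcases lt_trichotomy c 0 with hc | rfl | hc
    · have := pos _ (neg _ hv) (-c) (by linarith)
      simpa using this
    · exact ⟨1, one_pos, by simpa using hx⟩
    · exact pos _ hv c hc

/-- A common direction allows a small step from a common point inside both sets. Relative openness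
is essential here: two closed segments may meet in an end point only. -/
theorem vectorSpan_inter (hC : IsRelOpenConvex C) (hD : IsRelOpenConvex D)
    (hne : (C ∩ D).Nonempty) : vectorSpan ℝ (C ∩ D) = vectorSpan ℝ C ⊓ vectorSpan ℝ D := by
  refine le_antisymm (le_inf (vectorSpan_mono ℝ Set.inter_subset_left)
    (vectorSpan_mono ℝ Set.inter_subset_right)) ?_
  rintro v ⟨hv, hv'⟩
  obtain ⟨x, hx⟩ := hne
  obtain ⟨ε, hε, h⟩ := hC.exists_add_smul_mem hx.1 hv
  obtain ⟨δ, hδ, h'⟩ := hD.exists_add_smul_mem hx.2 hv'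
  have hm := lt_min hε hδ
  have h1 := add_smul_mem_of_le hC.convex hx.1 hm.le (min_le_left _ _) h
  have h2 := add_smul_mem_of_le hD.convex hx.2 hm.le (min_le_right _ _) h'
  have := vsub_mem_vectorSpan ℝ (s := C ∩ D) (p₁ := x + min ε δ • v) ⟨h1, h2⟩ hx
  rw [vsub_eq_sub, add_sub_cancel_left] at this
  simpa [smul_smul, hm.ne'] using Submodule.smul_mem _ (min ε δ)⁻¹ this

theorem vectorSpan_hyperplane (f : V →ₗ[ℝ] ℝ) {t : ℝ} {x : V} (hx : f x = t) :
    vectorSpan ℝ {y | f y = t} = LinearMap.ker f := by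
  refine le_antisymm ?_ fun v hv => ?_
  · rw [vectorSpan_def, Submodule.span_le]
    rintro _ ⟨y, hy, z, hz, rfl⟩
    simp only [Set.mem_ofPred_eq] at hy hz
    simp [hy, hz]
  · have := vsub_mem_vectorSpan ℝ (s := {y | f y = t}) (p₁ := x + v) (p₂ := x)
      (by simp [hx, LinearMap.mem_ker.1 hv]) hx
    simpa using this

theorem finrank_inf_ker [FiniteDimensional ℝ V] (W : Submodule ℝ V) (f : V →ₗ[ℝ] ℝ) {w : V}
    (hw : w ∈ W) (hf : f w ≠ 0) :
    Module.finrank ℝ (W ⊓ LinearMap.ker f : Submodule ℝ V) + 1 = Module.finrank ℝ W := by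
  have h := LinearMap.finrank_range_add_finrank_ker (f.domRestrict W)
  have hr : LinearMap.range (f.domRestrict W) = ⊤ := by
    rw [LinearMap.range_eq_top]
    refine LinearMap.surjective_of_ne_zero fun h0 => hf ?_
    simpa using LinearMap.congr_fun h0 ⟨w, hw⟩
  rw [hr, finrank_top, Module.finrank_self, ← Submodule.finrank_map_subtype_eq W] at h
  have : Submodule.map W.subtype (LinearMap.ker (f.domRestrict W)) = W ⊓ LinearMap.ker f := by
    ext v
    simp only [Submodule.mem_map, LinearMap.mem_ker, Submodule.mem_inf, Subtype.exists]
    constructor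
    · rintro ⟨a, ha, h, rfl⟩
      exact ⟨ha, h⟩
    · rintro ⟨ha, h⟩
      exact ⟨v, ha, h, rfl⟩
  rw [← h, add_comm, this]

/-! ### Relatively open convex subsets of the real line. -/

theorem ordConnected {J : Set ℝ} (hJ : IsRelOpenConvex J) : J.OrdConnected := hJ.convex.ordConnected

theorem isOpen_real {J : Set ℝ} (hJ : IsRelOpenConvex J) (hs : ¬ J.Subsingleton) : IsOpen J := by
  rw [isOpen_iff_mem_nhds]
  intro x hx
  obtain ⟨y, hy, hne⟩ : ∃ y ∈ J, y ≠ x := by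
    by_contra! h
    exact hs fun a ha b hb => (h a ha).trans (h b hb).symm
  obtain ⟨ε, hε, h⟩ := hJ.prolong x hx y hy
  simp only [smul_eq_mul] at h
  rcases hne.lt_or_gt with hlt | hlt
  · exact Filter.mem_of_superset (Icc_mem_nhds hlt (by nlinarith)) (hJ.ordConnected.out hy h)
  · exact Filter.mem_of_superset (Icc_mem_nhds (by nlinarith) hlt) (hJ.ordConnected.out h hy)

theorem eventually_nhdsGT_mem_iff {J : Set ℝ} (hJ : IsRelOpenConvex J) (hne : J.Nonempty)
    (hs : ¬ J.Subsingleton) (t : ℝ) :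
    ∀ᶠ s in 𝓝[>] t, (s ∈ J ↔ t ∈ J ∨ (BddBelow J ∧ sInf J = t)) := by
  by_cases ht : t ∈ J
  · filter_upwards [mem_nhdsWithin_of_mem_nhds ((hJ.isOpen_real hs).mem_nhds ht)] with s hs
    simp [hs, ht]
  by_cases hb : BddBelow J ∧ sInf J = t
  · obtain ⟨y, hy⟩ := hne
    have hty : t < y := (hb.2 ▸ csInf_le hb.1 hy).lt_of_ne fun h => ht (h ▸ hy)
    filter_upwards [Ioo_mem_nhdsGT hty] with s hs
    have : s ∈ J := by
      obtain ⟨z, hz, hzs⟩ := exists_lt_of_csInf_lt ⟨y, hy⟩ (hb.2.symm ▸ hs.1 : sInf J < s)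
      exact hJ.ordConnected.out hz hy ⟨hzs.le, hs.2.le⟩
    simp [this, hb]
  · simp only [ht, hb, or_self, iff_false]
    by_cases hlt : ∃ y ∈ J, y < t
    · obtain ⟨y, hy, hyt⟩ := hlt
      filter_upwards [self_mem_nhdsWithin] with s hs hsJ
      exact ht (hJ.ordConnected.out hy hsJ ⟨hyt.le, le_of_lt hs⟩)
    · push Not at hlt
      have hbd : BddBelow J := ⟨t, hlt⟩
      have : t < sInf J := (le_csInf hne hlt).lt_of_ne fun h => hb ⟨hbd, h.symm⟩
      filter_upwards [Ioo_mem_nhdsGT this] with s hs hsJ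
      exact absurd (csInf_le hbd hsJ) (not_le.2 hs.2)

theorem eventually_atBot_mem_iff {J : Set ℝ} (hJ : IsRelOpenConvex J) (hne : J.Nonempty) :
    ∀ᶠ s in Filter.atBot, (s ∈ J ↔ ¬ BddBelow J) := by
  by_cases hb : BddBelow J
  · obtain ⟨m, hm⟩ := hb
    filter_upwards [Filter.eventually_lt_atBot m] with s hs
    have hb : BddBelow J := ⟨m, hm⟩
    simp only [hb, not_true_eq_false, iff_false]
    exact fun h => absurd (hm h) (not_le.2 hs)
  · obtain ⟨y, hy⟩ := hne
    filter_upwards [Filter.eventually_le_atBot y] with s hs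
    simp only [hb, not_false_eq_true, iff_true]
    rw [not_bddBelow_iff] at hb
    obtain ⟨z, hz, hzs⟩ := hb s
    exact hJ.ordConnected.out hz hy ⟨hzs.le, hs⟩

open Classical in
-- Each `J i` is a point or an open interval. For an indicator function, the sum over `t` of its
-- value at `t` minus its right limit at `t`, minus its limit at `-∞`, is `1` for a point and `-1`
-- for an open interval. This expression is linear, so it vanishes on the given relation.
theorem sum_eq_zero_real {ι : Type*} (s : Finset ι) (J : ι → Set ℝ) (n : ι → ℤ)
    (hJ : ∀ i ∈ s, IsRelOpenConvex (J i)) (hne : ∀ i ∈ s, (J i).Nonempty)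
    (h : ∀ t, ∑ i ∈ s, (if t ∈ J i then n i else 0) = 0) :
    ∑ i ∈ s, (if (J i).Subsingleton then n i else - n i) = 0 := by
  let R : ι → ℝ → Prop := fun i t =>
    ¬ (J i).Subsingleton ∧ (t ∈ J i ∨ (BddBelow (J i) ∧ sInf (J i) = t))
  let B : ι → Prop := fun i => ¬ BddBelow (J i)
  -- Value and right limit differ only at an infimum. For `J i` unbounded below, `sInf` has the
  -- default value `0`, which at most adds a harmless point to `T`.
  let T : Finset ℝ := s.image fun i => sInf (J i)
  have hR : ∀ t, ∑ i ∈ s, (if R i t then n i else 0) = 0 := by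
    intro t
    have hev : ∀ᶠ u in 𝓝[>] t, ∀ i ∈ s, (u ∈ J i ↔ R i t) := by
      rw [Filter.eventually_all_finset]
      intro i hi
      by_cases hs : (J i).Subsingleton
      · obtain ⟨p, hp⟩ := hne i hi
        have hp' : ∀ᶠ u in 𝓝[>] t, u ≠ p := by
          rcases le_or_gt p t with h | h
          · filter_upwards [self_mem_nhdsWithin] with u hu
            exact (h.trans_lt hu).ne'
          · filter_upwards [Ioo_mem_nhdsGT h] with u hu
            exact hu.2.ne
        filter_upwards [hp'] with u hu
        simp only [R, hs, not_true_eq_false, false_and, iff_false]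
        exact fun h => hu (hs h hp)
      · simpa only [R, hs, not_false_eq_true, true_and] using
          (hJ i hi).eventually_nhdsGT_mem_iff (hne i hi) hs t
    obtain ⟨u, hu⟩ := hev.exists
    exact (Finset.sum_congr rfl fun i hi => by simp only [hu i hi]).trans (h u)
  have hB : ∑ i ∈ s, (if B i then n i else 0) = 0 := by
    have hev : ∀ᶠ u in Filter.atBot, ∀ i ∈ s, (u ∈ J i ↔ B i) := by
      rw [Filter.eventually_all_finset]
      exact fun i hi => (hJ i hi).eventually_atBot_mem_iff (hne i hi)
    obtain ⟨u, hu⟩ := hev.exists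
    exact (Finset.sum_congr rfl fun i hi => by simp only [hu i hi]).trans (h u)
  have key : ∀ i ∈ s, (if (J i).Subsingleton then n i else - n i) =
      ∑ t ∈ T, ((if t ∈ J i then n i else 0) - (if R i t then n i else 0)) -
        (if B i then n i else 0) := by
    intro i hi
    have hiT : sInf (J i) ∈ T := Finset.mem_image_of_mem _ hi
    by_cases hs : (J i).Subsingleton
    · obtain ⟨p, hp⟩ := hne i hi
      have hJi : J i = {p} := Set.eq_singleton_iff_unique_mem.2 ⟨hp, fun x hx => hs hx hp⟩
      have hb : ¬ B i := by simp [B, hJi]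
      rw [if_pos hs, if_neg hb, sub_zero, Finset.sum_eq_single_of_mem _ hiT]
      · simp [R, hJi]
      · intro t _ ht
        have : t ∉ J i := by
          rw [hJi] at ht ⊢
          simpa using ht
        simp [R, hs, this]
    · have hterm : ∀ t, ((if t ∈ J i then n i else 0) - (if R i t then n i else 0)) =
          if BddBelow (J i) ∧ sInf (J i) = t then - n i else 0 := by
        intro t
        by_cases ht : t ∈ J i
        · have : ¬ (BddBelow (J i) ∧ sInf (J i) = t) := by
            rintro ⟨hb, hbt⟩
            -- `a` and `hat` are the end points of an open interval around `t` inside `J i`; the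
            -- midpoint of `a` and `t` then lies in `J i` below `t`, so `t` is not the infimum.
            obtain ⟨a, hat, ha⟩ := (mem_nhds_iff_exists_Ioo_subset.1
              (((hJ i hi).isOpen_real hs).mem_nhds ht)).imp fun a h => h
            have hm : (a + t) / 2 ∈ J i := ha.2 ⟨by linarith [ha.1.1], by linarith [ha.1.1, ha.1.2]⟩
            have := csInf_le hb hm
            linarith [ha.1.1]
          simp only [R, ht, this, hs, not_false_eq_true, true_and, true_or, if_true, if_false,
            sub_self]
        · by_cases hb : BddBelow (J i) ∧ sInf (J i) = t
          · simp only [R, ht, hb, hs, not_false_eq_true, false_or, if_true, if_false,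
              zero_sub, and_self]
          · simp [R, ht, hb]
      rw [if_neg hs, Finset.sum_congr rfl fun t _ => hterm t]
      by_cases hb : BddBelow (J i)
      · simp [B, hb, hiT]
      · simp [B, hb]
  rw [Finset.sum_congr rfl key, Finset.sum_sub_distrib, hB, sub_zero, Finset.sum_comm]
  exact Finset.sum_eq_zero fun t _ => by rw [Finset.sum_sub_distrib, h, hR, sub_zero]

open Classical in
/-- The Euler relation: the weight `(-1) ^ dim C` respects linear relations between the indicator
functions of relatively open convex sets. -/
theorem sum_neg_one_pow_finrank_eq_zero {V : Type*} [AddCommGroup V] [Module ℝ V]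
    [FiniteDimensional ℝ V] {ι : Type*} (s : Finset ι) (C : ι → Set V) (n : ι → ℤ)
    (hC : ∀ i ∈ s, IsRelOpenConvex (C i)) (hne : ∀ i ∈ s, (C i).Nonempty)
    (h : ∀ x, ∑ i ∈ s, (if x ∈ C i then n i else 0) = 0) :
    ∑ i ∈ s, n i * (-1) ^ Module.finrank ℝ (vectorSpan ℝ (C i)) = 0 := by
  -- The induction runs over the dimension of a subspace `W` containing all differences of points,
  -- so that slices stay in the same ambient space.
  suffices H : ∀ (k : ℕ) (s : Finset ι) (C : ι → Set V) (n : ι → ℤ) (W : Submodule ℝ V),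
      Module.finrank ℝ W = k → (∀ i ∈ s, ∀ j ∈ s, ∀ x ∈ C i, ∀ y ∈ C j, x - y ∈ W) →
      (∀ i ∈ s, IsRelOpenConvex (C i)) → (∀ i ∈ s, (C i).Nonempty) →
      (∀ x, ∑ i ∈ s, (if x ∈ C i then n i else 0) = 0) →
      ∑ i ∈ s, n i * (-1) ^ Module.finrank ℝ (vectorSpan ℝ (C i)) = 0 from
    H _ s C n ⊤ rfl (by simp) hC hne h
  clear hC hne h s C n
  intro k
  induction k with
  | zero =>
    intro s C n W hW hsub hC hne h
    rcases s.eq_empty_or_nonempty with rfl | ⟨i₀, hi₀⟩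
    · simp
    obtain ⟨x₀, hx₀⟩ := hne i₀ hi₀
    have hW0 : W = ⊥ := Submodule.finrank_eq_zero.1 hW
    have hCi : ∀ i ∈ s, C i = {x₀} := fun i hi =>
      Set.eq_singleton_iff_nonempty_unique_mem.2 ⟨hne i hi, fun x hx => by
        simpa [hW0, sub_eq_zero] using hsub i hi i₀ hi₀ x hx x₀ hx₀⟩
    refine (Finset.sum_congr rfl fun i hi => ?_).trans (h x₀)
    rw [hCi i hi, vectorSpan_singleton, finrank_bot]
    simp
  | succ k ih =>
    intro s C n W hW hsub hC hne h
    obtain ⟨w, hw, hw0⟩ : ∃ w ∈ W, w ≠ 0 := by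
      by_contra! hcon
      have : W = ⊥ := (Submodule.eq_bot_iff W).2 hcon
      rw [this, finrank_bot] at hW
      omega
    obtain ⟨f, hf⟩ : ∃ f : Module.Dual ℝ V, f w ≠ 0 := by
      by_contra! hcon
      exact hw0 ((Module.forall_dual_apply_eq_zero_iff ℝ w).1 hcon)
    have hdim : ∀ i ∈ s, ∀ t ∈ f '' C i,
        (-1 : ℤ) ^ Module.finrank ℝ (vectorSpan ℝ (C i ∩ {x | f x = t})) =
          if (f '' C i).Subsingleton then (-1) ^ Module.finrank ℝ (vectorSpan ℝ (C i))
            else - (-1) ^ Module.finrank ℝ (vectorSpan ℝ (C i)) := by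
      rintro i hi _ ⟨x, hx, rfl⟩
      split_ifs with hs
      · have : C i ∩ {y | f y = f x} = C i := Set.inter_eq_left.2 fun y hy =>
          hs (Set.mem_image_of_mem _ hy) (Set.mem_image_of_mem _ hx)
        rw [this]
      · obtain ⟨y, hy, hyx⟩ : ∃ y ∈ C i, f y ≠ f x := by
          by_contra! hcon
          refine hs ?_
          rintro _ ⟨a, ha, rfl⟩ _ ⟨b, hb, rfl⟩
          rw [hcon a ha, hcon b hb]
        rw [(hC i hi).vectorSpan_inter (hyperplane f _) ⟨x, hx, rfl⟩, vectorSpan_hyperplane f rfl,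
          ← finrank_inf_ker _ f (vsub_mem_vectorSpan ℝ hy hx) (by simpa [sub_eq_zero] using hyx),
          pow_succ]
        ring
    -- The slices by `f = t` satisfy the relation in `W ⊓ ker f`. The sign of a slice does not
    -- depend on `t`, so the induction hypothesis is a relation between the indicators of the images
    -- `f '' C i`, with these signs as weights. The one-dimensional case flips the sign exactly
    -- where slicing lowered the dimension.
    have h1 := sum_eq_zero_real s (fun i => f '' C i)
      (fun i => n i * if (f '' C i).Subsingleton then (-1) ^ Module.finrank ℝ (vectorSpan ℝ (C i))
            else - (-1) ^ Module.finrank ℝ (vectorSpan ℝ (C i)))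
      (fun i hi => (hC i hi).image f) (fun i hi => (hne i hi).image f) (fun t => ?_)
    · rw [← h1]
      refine Finset.sum_congr rfl fun i _ => ?_
      split_ifs <;> ring
    · have h2 := ih (s.filter fun i => t ∈ f '' C i) (fun i => C i ∩ {x | f x = t}) n
        (W ⊓ LinearMap.ker f) (by have := finrank_inf_ker W f hw hf; omega) ?_ ?_ ?_ ?_
      · rw [Finset.sum_filter] at h2
        refine (Finset.sum_congr rfl fun i hi => ?_).trans h2
        split_ifs with ht hs
        · rw [hdim i hi t ht, if_pos hs]
        · rw [hdim i hi t ht, if_neg hs]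
        · rfl
      · intro i hi j hj x hx y hy
        refine ⟨hsub i (Finset.mem_filter.1 hi).1 j (Finset.mem_filter.1 hj).1 x hx.1 y hy.1, ?_⟩
        have h1 : f x = t := hx.2
        have h2 : f y = t := hy.2
        simp [h1, h2]
      · exact fun i hi => (hC i (Finset.mem_filter.1 hi).1).inter (hyperplane f t)
      · intro i hi
        obtain ⟨x, hx, hxt⟩ := (Finset.mem_filter.1 hi).2
        exact ⟨x, hx, hxt⟩
      · intro x
        by_cases hx : f x = t
        · rw [Finset.sum_filter]
          refine (Finset.sum_congr rfl fun i _ => ?_).trans (h x)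
          by_cases hxi : x ∈ C i
          · have : t ∈ f '' C i := ⟨x, hxi, hx⟩
            simp only [this, hxi, hx, if_true, Set.mem_inter_iff, Set.mem_ofPred_eq, and_self]
          · simp [hxi]
        · exact Finset.sum_eq_zero fun i _ => if_neg fun hxi => hx hxi.2

end IsRelOpenConvex

/-! ### Systems of linear inequalities -/

/-- Farkas' lemma. -/
theorem exists_nonneg_combination_of_forall_nonpos {E ι : Type*} [AddCommGroup E] [Module ℝ E]
    (s : Finset ι) (a : ι → E →ₗ[ℝ] ℝ) (c : E →ₗ[ℝ] ℝ)
    (h : ∀ z, (∀ i ∈ s, a i z ≤ 0) → c z ≤ 0) :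
    ∃ r : ι → ℝ, (∀ i, 0 ≤ r i) ∧ c = ∑ i ∈ s, r i • a i := by
  classical
  induction s using Finset.induction_on generalizing a c with
  | empty =>
    refine ⟨0, fun _ => le_rfl, ?_⟩
    ext z
    have h1 := h z (by simp)
    have h2 := h (-z) (by simp)
    rw [map_neg] at h2
    simp only [Finset.sum_empty, LinearMap.zero_apply]
    linarith
  | insert k s hk ih =>
    by_cases hc : ∀ z, (∀ i ∈ s, a i z ≤ 0) → c z ≤ 0
    · obtain ⟨r, hr, hrc⟩ := ih a c hc
      refine ⟨Function.update r k 0, fun i => ?_, ?_⟩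
      · by_cases hi : i = k
        · simp [hi]
        · simp [hi, hr]
      · rw [Finset.sum_insert hk, Function.update_self, zero_smul, zero_add, hrc]
        refine Finset.sum_congr rfl fun i hi => ?_
        rw [Function.update_of_ne (ne_of_mem_of_not_mem hi hk)]
    · push Not at hc
      obtain ⟨x, hx, hcx⟩ := hc
      have hkx : 0 < a k x := by
        by_contra! hneg
        refine absurd (h x fun i hi => ?_) (not_le.2 hcx)
        rcases Finset.mem_insert.1 hi with rfl | hi
        · exact hneg
        · exact hx i hi
      -- All forms are corrected by multiples of `a k` so as to vanish at `x`. This amounts to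
      -- projecting along `x` onto the kernel of `a k`, where the constraint `k` is void.
      obtain ⟨r, hr, hrc⟩ := ih (fun i => a i - (a i x / a k x) • a k)
        (c - (c x / a k x) • a k) (fun z hz => by
          have := h (z - (a k z / a k x) • x) (fun i hi => by
            rcases Finset.mem_insert.1 hi with rfl | hi
            · simp [hkx.ne']
            · have := hz i hi
              simp only [LinearMap.sub_apply, LinearMap.smul_apply, smul_eq_mul, map_sub,
                map_smul] at this ⊢
              convert this using 2
              ring)
          simp only [LinearMap.sub_apply, LinearMap.smul_apply, smul_eq_mul, map_sub,
                map_smul] at this ⊢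
          convert this using 2
          ring)
      have hsum : 0 ≤ c x / a k x - ∑ i ∈ s, r i * (a i x / a k x) := by
        have : ∑ i ∈ s, r i * (a i x / a k x) ≤ 0 := Finset.sum_nonpos fun i hi =>
          mul_nonpos_of_nonneg_of_nonpos (hr i) (div_nonpos_of_nonpos_of_nonneg (hx i hi) hkx.le)
        have : 0 < c x / a k x := by positivity
        linarith
      refine ⟨Function.update r k (c x / a k x - ∑ i ∈ s, r i * (a i x / a k x)), fun i => ?_, ?_⟩
      · by_cases hi : i = k
        · simpa [hi] using hsum
        · simp [hi, hr]
      · rw [Finset.sum_insert hk, Function.update_self]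
        have : ∑ i ∈ s, Function.update r k (c x / a k x - ∑ i ∈ s, r i * (a i x / a k x)) i • a i =
            ∑ i ∈ s, r i • a i := Finset.sum_congr rfl fun i hi => by
          rw [Function.update_of_ne (ne_of_mem_of_not_mem hi hk)]
        rw [this]
        have hc' : c = ∑ i ∈ s, r i • (a i - (a i x / a k x) • a k) + (c x / a k x) • a k :=
          sub_eq_iff_eq_add.1 hrc
        conv_lhs => rw [hc']
        have hss : ∀ (p q : ℝ) (y : E →ₗ[ℝ] ℝ), (p - q) • y = p • y - q • y := fun p q y => by
          ext z
          simp [sub_mul]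
        rw [hss, Finset.sum_smul]
        simp only [smul_sub, Finset.sum_sub_distrib, smul_smul]
        abel

/-- The solution set of a system of linear inequalities. -/
def polyhedron {d : ℕ} {ι : Type*} (A : ι → StrongDual ℝ (Fin d → ℝ)) (b : ι → ℝ) :
    Set (Fin d → ℝ) :=
  {x | ∀ i, A i x ≤ b i}

/-- The linear functional with given coefficients. -/
def coeffForm {d : ℕ} (a : Fin d → ℝ) : StrongDual ℝ (Fin d → ℝ) :=
  ∑ j, a j • ContinuousLinearMap.proj j

theorem coeffForm_apply {d : ℕ} (a x : Fin d → ℝ) : coeffForm a x = ∑ j, a j * x j := by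
  simp [coeffForm]

theorem IsPolyhedron.exists_eq_polyhedron {d : ℕ} {P : Set (Fin d → ℝ)} (hP : IsPolyhedron P) :
    ∃ (m : ℕ) (A : Fin m → StrongDual ℝ (Fin d → ℝ)) (b : Fin m → ℝ), P = polyhedron A b := by
  obtain ⟨m, A, b, rfl⟩ := hP
  exact ⟨m, fun i => coeffForm (A i), b, by simp [polyhedron, coeffForm_apply]⟩

theorem convex_polyhedron {d : ℕ} {ι : Type*} {A : ι → StrongDual ℝ (Fin d → ℝ)} {b : ι → ℝ} :
    Convex ℝ (polyhedron A b) := by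
  intro x hx y hy s t hs ht hst i
  rw [map_add, map_smul, map_smul, smul_eq_mul, smul_eq_mul, ← one_mul (b i), ← hst, add_mul]
  exact add_le_add (mul_le_mul_of_nonneg_left (hx i) hs) (mul_le_mul_of_nonneg_left (hy i) ht)

section Polyhedron

variable {d : ℕ} {ι : Type*} [Fintype ι] {A : ι → StrongDual ℝ (Fin d → ℝ)} {b : ι → ℝ}

/-- If the supremum `M` is not attained, the system `A x ≤ b`, `l x ≥ M` is infeasible. Farkas'
lemma then bounds `M - l x` below by a positive constant on the polyhedron, which contradicts the
choice of `M`. -/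
theorem toExposed_polyhedron_nonempty (hne : (polyhedron A b).Nonempty)
    (l : StrongDual ℝ (Fin d → ℝ)) (hl : BddAbove (l '' polyhedron A b)) :
    (l.toExposed (polyhedron A b)).Nonempty := by
  set M := sSup (l '' polyhedron A b) with hM
  have hle : ∀ x ∈ polyhedron A b, l x ≤ M := fun x hx => le_csSup hl ⟨x, hx, rfl⟩
  by_contra hempty
  have hlt : ∀ x ∈ polyhedron A b, l x < M := fun x hx => (hle x hx).lt_of_ne fun h =>
    hempty ⟨x, hx, fun y hy => (hle y hy).trans h.ge⟩
  -- The system is homogenised by a variable `t`: the constraints are `-t ≤ 0`, `M t ≤ l z` and `A i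
  -- z ≤ b i t`, and they force `t ≤ 0`.
  let a : Option (Option ι) → ((Fin d → ℝ) × ℝ) →ₗ[ℝ] ℝ := fun o => match o with
    | none => - LinearMap.snd ℝ _ _
    | some none => M • LinearMap.snd ℝ _ _ - (l : (Fin d → ℝ) →ₗ[ℝ] ℝ) ∘ₗ LinearMap.fst ℝ _ _
    | some (some i) => (A i : (Fin d → ℝ) →ₗ[ℝ] ℝ) ∘ₗ LinearMap.fst ℝ _ _ -
        b i • LinearMap.snd ℝ _ _
  obtain ⟨r, hr, h⟩ := exists_nonneg_combination_of_forall_nonpos Finset.univ a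
    (LinearMap.snd ℝ _ _) (by
      rintro ⟨z, t⟩ hz
      by_contra! ht
      have ht : 0 < t := ht
      have h1 : t⁻¹ • z ∈ polyhedron A b := fun i => by
        have := hz (some (some i)) (Finset.mem_univ _)
        simp only [a, LinearMap.sub_apply, LinearMap.comp_apply, LinearMap.fst_apply,
          LinearMap.smul_apply, LinearMap.snd_apply, smul_eq_mul,
          ContinuousLinearMap.coe_coe] at this
        rw [map_smul, smul_eq_mul, inv_mul_le_iff₀ ht]
        linarith
      have h2 := hz (some none) (Finset.mem_univ _)
      simp only [a, LinearMap.sub_apply, LinearMap.comp_apply, LinearMap.fst_apply,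
          LinearMap.smul_apply, LinearMap.snd_apply, smul_eq_mul,
          ContinuousLinearMap.coe_coe] at h2
      have h3 := hlt _ h1
      rw [map_smul, smul_eq_mul, inv_mul_lt_iff₀ ht] at h3
      linarith)
  have key : ∀ x ∈ polyhedron A b, 1 ≤ r (some none) * (M - l x) := by
    intro x hx
    have := LinearMap.congr_fun h (x, 1)
    simp only [a, Fintype.sum_option, LinearMap.add_apply, LinearMap.sum_apply,
      LinearMap.sub_apply, LinearMap.comp_apply, LinearMap.fst_apply, LinearMap.neg_apply,
          LinearMap.smul_apply, LinearMap.snd_apply, smul_eq_mul,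
          ContinuousLinearMap.coe_coe] at this
    have hs : ∑ i, r (some (some i)) * (A i x - b i * 1) ≤ 0 := Finset.sum_nonpos fun i _ =>
      mul_nonpos_of_nonneg_of_nonpos (hr _) (by have := hx i; linarith)
    have := hr none
    linarith
  obtain ⟨x₀, hx₀⟩ := hne
  have hs : 0 < r (some none) := by
    have := key x₀ hx₀
    rcases (hr (some none)).eq_or_lt with h0 | h0
    · rw [← h0] at this
      linarith
    · exact h0
  have : M ≤ M - (r (some none))⁻¹ := by
    rw [hM]
    refine csSup_le ⟨_, x₀, hx₀, rfl⟩ ?_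
    rintro _ ⟨x, hx, rfl⟩
    have := key x hx
    rw [← inv_mul_le_iff₀ hs] at this
    linarith
  have : 0 < (r (some none))⁻¹ := by positivity
  linarith

theorem exists_add_smul_mem_polyhedron {x z : Fin d → ℝ} (hx : x ∈ polyhedron A b)
    (hz : ∀ i, A i x = b i → A i z ≤ 0) : ∃ ε : ℝ, 0 < ε ∧ x + ε • z ∈ polyhedron A b := by
  have : ∀ᶠ ε : ℝ in 𝓝[>] 0, ∀ i, A i (x + ε • z) ≤ b i := by
    rw [Filter.eventually_all]
    intro i
    by_cases hi : A i x = b i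
    · filter_upwards [self_mem_nhdsWithin] with ε hε
      rw [map_add, map_smul, smul_eq_mul, hi]
      have := mul_nonpos_of_nonneg_of_nonpos (le_of_lt hε) (hz i hi)
      linarith
    · have hlt : A i x < b i := (hx i).lt_of_ne hi
      have hc : Continuous fun ε : ℝ => A i (x + ε • z) := by fun_prop
      have := (hc.tendsto 0).eventually (gt_mem_nhds (by simpa using hlt))
      filter_upwards [mem_nhdsWithin_of_mem_nhds this] with ε hε
      exact le_of_lt hε
  obtain ⟨ε, h, hε⟩ := (this.and self_mem_nhdsWithin).exists
  exact ⟨ε, hε, h⟩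

end Polyhedron

/-! ### Faces and normal cones -/

section Face

variable {d : ℕ} {P : Set (Fin d → ℝ)}

theorem Face.exists_toExposed_eq (f : Face P) :
    ∃ l : StrongDual ℝ (Fin d → ℝ), l.toExposed P = f.1 := by
  obtain ⟨l, hl⟩ := f.2.2 f.2.1
  exact ⟨l, hl.symm⟩

theorem Face.subset (f : Face P) : f.1 ⊆ P := f.2.2.subset

/-- The face on which a functional is maximal. -/
def faceOf {l : StrongDual ℝ (Fin d → ℝ)} (h : (l.toExposed P).Nonempty) : Face P :=
  ⟨l.toExposed P, h, ContinuousLinearMap.toExposed.isExposed⟩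

theorem mem_normalCone_iff {f : Face P} {l : StrongDual ℝ (Fin d → ℝ)} :
    l ∈ normalCone f ↔ f.1 ⊆ l.toExposed P :=
  ⟨fun h x hx => ⟨f.subset hx, h x hx⟩, fun h _ hx => (h hx).2⟩

theorem mem_normalCone_of_eq {f : Face P} {l : StrongDual ℝ (Fin d → ℝ)}
    (h : l.toExposed P = f.1) : l ∈ normalCone f := mem_normalCone_iff.2 h.ge

theorem normalCone_apply_eq {f : Face P} {l : StrongDual ℝ (Fin d → ℝ)} (h : l ∈ normalCone f)
    {x y : Fin d → ℝ} (hx : x ∈ f.1) (hy : y ∈ f.1) : l x = l y :=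
  le_antisymm (h y hy x (f.subset hx)) (h x hx y (f.subset hy))

theorem normalCone_antitone {f g : Face P} (h : f.1 ⊆ g.1) : normalCone g ⊆ normalCone f :=
  fun _ hl x hx => hl x (h hx)

theorem normalCone_subset_iff {f g : Face P} : normalCone f ⊆ normalCone g ↔ g.1 ⊆ f.1 := by
  refine ⟨fun h => ?_, normalCone_antitone⟩
  obtain ⟨l, hl⟩ := f.exists_toExposed_eq
  rw [← hl]
  exact mem_normalCone_iff.1 (h (mem_normalCone_of_eq hl))

theorem normalCone_injective : Function.Injective (normalCone (P := P)) := fun _ _ h =>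
  Subtype.ext ((normalCone_subset_iff.1 h.ge).antisymm (normalCone_subset_iff.1 h.le))

theorem smul_mem_normalCone {f : Face P} {l : StrongDual ℝ (Fin d → ℝ)} (hl : l ∈ normalCone f)
    {c : ℝ} (hc : 0 ≤ c) : c • l ∈ normalCone f :=
  fun x hx y hy => mul_le_mul_of_nonneg_left (hl x hx y hy) hc

theorem toExposed_add {l m : StrongDual ℝ (Fin d → ℝ)}
    (h : (l.toExposed P ∩ m.toExposed P).Nonempty) :
    (l + m).toExposed P = l.toExposed P ∩ m.toExposed P := by
  obtain ⟨w, hl, hm⟩ := h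
  refine Set.Subset.antisymm ?_ ?_
  · rintro x ⟨hx, h⟩
    have := h w hl.1
    simp only [add_apply] at this
    have h1 := hl.2 x hx
    have h2 := hm.2 x hx
    exact ⟨⟨hx, fun y hy => (hl.2 y hy).trans (by linarith)⟩,
      ⟨hx, fun y hy => (hm.2 y hy).trans (by linarith)⟩⟩
  · rintro x ⟨h1, h2⟩
    exact ⟨h1.1, fun y hy => add_le_add (h1.2 y hy) (h2.2 y hy)⟩

theorem toExposed_smul (l : StrongDual ℝ (Fin d → ℝ)) {c : ℝ} (hc : 0 < c) :
    (c • l).toExposed P = l.toExposed P := by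
  ext x
  refine and_congr_right fun _ => forall₂_congr fun y _ => ?_
  simp [hc]

theorem IsMinFace.unique {x : Fin d → ℝ} {f g : Face P} (hf : IsMinFace x f)
    (hg : IsMinFace x g) : f = g :=
  Subtype.ext ((hf.2 g hg.1).antisymm (hg.2 f hf.1))

end Face

theorem Face.convex {d : ℕ} {ι : Type*} {A : ι → StrongDual ℝ (Fin d → ℝ)} {b : ι → ℝ}
    (f : Face (polyhedron A b)) : Convex ℝ f.1 :=
  f.2.2.convex convex_polyhedron

section PolyhedronFace

variable {d : ℕ} {ι : Type*} [Fintype ι] {A : ι → StrongDual ℝ (Fin d → ℝ)} {b : ι → ℝ}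

/-- The segment from `y` to `x` can be prolonged beyond `x` inside the polyhedron, so a functional
that is maximal at `x` is maximal at `y` as well. -/
theorem mem_of_tight_subset {f : Face (polyhedron A b)} {x y : Fin d → ℝ} (hx : x ∈ f.1)
    (hy : y ∈ polyhedron A b) (h : ∀ i, A i x = b i → A i y = b i) : y ∈ f.1 := by
  obtain ⟨l, hl⟩ := f.exists_toExposed_eq
  obtain ⟨ε, hε, hmem⟩ := exists_add_smul_mem_polyhedron (z := x - y) (f.subset hx)
    (fun i hi => by rw [map_sub, hi, h i hi, sub_self])
  rw [← hl] at hx ⊢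
  have h1 := hx.2 _ hmem
  rw [map_add, map_smul, map_sub, smul_eq_mul] at h1
  have h2 : l x ≤ l y := by nlinarith
  exact ⟨hy, fun z hz => (hx.2 z hz).trans h2⟩

open Classical in
-- The sum of the functionals tight at `x` exposes exactly the set on which all of them stay tight;
-- `mem_of_tight_subset` gives minimality.
theorem exists_isMinFace {x : Fin d → ℝ} (hx : x ∈ polyhedron A b) :
    ∃ f : Face (polyhedron A b), IsMinFace x f ∧
      f.1 = {y ∈ polyhedron A b | ∀ i, A i x = b i → A i y = b i} := by
  let l : StrongDual ℝ (Fin d → ℝ) := ∑ i with A i x = b i, A i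
  have hl : ∀ y, l y = ∑ i with A i x = b i, A i y := fun y => by simp [l]
  have hlx : l x = ∑ i with A i x = b i, b i := by
    rw [hl]
    exact Finset.sum_congr rfl fun i hi => (Finset.mem_filter.1 hi).2
  have hmax : ∀ y ∈ polyhedron A b, l y ≤ l x := fun y hy => by
    rw [hl, hlx]
    exact Finset.sum_le_sum fun i _ => hy i
  have heq : l.toExposed (polyhedron A b) =
      {y ∈ polyhedron A b | ∀ i, A i x = b i → A i y = b i} := by
    ext y
    refine and_congr_right fun hy => ⟨fun h i hi => ?_, fun h z hz => ?_⟩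
    · have h1 : l y = l x := le_antisymm (hmax y hy) (h x hx)
      rw [hl, hlx, Finset.sum_eq_sum_iff_of_le fun i _ => hy i] at h1
      exact h1 i (by simp [hi])
    · refine (hmax z hz).trans (le_of_eq ?_)
      rw [hl, hl]
      exact Finset.sum_congr rfl fun i hi => by
        have hi := (Finset.mem_filter.1 hi).2
        rw [hi, h i hi]
  refine ⟨faceOf (l := l) ⟨x, hx, hmax⟩, ⟨⟨hx, hmax⟩, fun g hg y hy => ?_⟩, heq⟩
  have hy : y ∈ l.toExposed (polyhedron A b) := hy
  rw [heq] at hy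
  exact mem_of_tight_subset hg hy.1 hy.2

open Classical in
/-- Every face contains a point at which only those inequalities are tight that are tight on the
whole face. -/
theorem Face.exists_mem_relint (f : Face (polyhedron A b)) :
    ∃ x ∈ f.1, ∀ i, A i x = b i → ∀ y ∈ f.1, A i y = b i := by
  have hex : ∃ n, ∃ x ∈ f.1, (Finset.univ.filter fun i => A i x = b i).card = n := by
    obtain ⟨x, hx⟩ := f.2.1
    exact ⟨_, x, hx, rfl⟩
  obtain ⟨x, hx, hn⟩ := Nat.find_spec hex
  refine ⟨x, hx, fun i hi y hy => ?_⟩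
  by_contra hne
  -- At the midpoint only the inequalities tight at both `x` and `y` are tight, so its tight set is
  -- smaller than the minimal one at `x`.
  have hm : (1 / 2 : ℝ) • x + (1 / 2 : ℝ) • y ∈ f.1 :=
    f.convex hx hy (by norm_num) (by norm_num) (by norm_num)
  refine Nat.find_min hex ?_ ⟨_, hm, rfl⟩
  rw [← hn]
  refine Finset.card_lt_card (Finset.ssubset_iff_subset_ne.2 ⟨fun j hj => ?_, fun h => ?_⟩)
  · simp only [Finset.mem_filter_univ, map_add, map_smul, smul_eq_mul] at hj ⊢
    have h1 := f.subset hx j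
    have h2 := f.subset hy j
    linarith
  · have : i ∈ Finset.univ.filter fun i => A i x = b i := by simp [hi]
    rw [← h] at this
    simp only [Finset.mem_filter_univ, map_add, map_smul, smul_eq_mul] at this
    exact hne (by linarith)

/-- A face is determined by the set of inequalities that are tight on it. -/
theorem finite_face : Finite (Face (polyhedron A b)) := by
  refine Finite.of_injective (fun f : Face (polyhedron A b) => {i | ∀ y ∈ f.1, A i y = b i}) ?_
  have key : ∀ f g : Face (polyhedron A b), {i | ∀ y ∈ f.1, A i y = b i} ⊆
      {i | ∀ y ∈ g.1, A i y = b i} → g.1 ⊆ f.1 := by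
    intro f g h y hy
    obtain ⟨x, hx, hrel⟩ := f.exists_mem_relint
    exact mem_of_tight_subset hx (g.subset hy) fun i hi => h (hrel i hi) y hy
  intro f g h
  exact Subtype.ext ((key g f h.ge).antisymm (key f g h.le))

theorem Face.vectorSpan_eq (f : Face (polyhedron A b)) :
    vectorSpan ℝ f.1 = ⨅ i ∈ {i | ∀ y ∈ f.1, A i y = b i},
      LinearMap.ker (A i : (Fin d → ℝ) →ₗ[ℝ] ℝ) := by
  apply le_antisymm
  · rw [vectorSpan_def, Submodule.span_le]
    rintro _ ⟨x, hx, y, hy, rfl⟩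
    simp only [SetLike.mem_coe, Submodule.mem_iInf, LinearMap.mem_ker]
    intro i hi
    simp [hi x hx, hi y hy]
  · intro z hz
    simp only [Submodule.mem_iInf, LinearMap.mem_ker] at hz
    obtain ⟨x, hx, hrel⟩ := f.exists_mem_relint
    obtain ⟨ε, hε, hmem⟩ := exists_add_smul_mem_polyhedron (z := z) (f.subset hx)
      (fun i hi => (hz i (hrel i hi)).le)
    have hz' : x + ε • z ∈ f.1 := mem_of_tight_subset hx hmem fun i hi => by
      have : A i z = 0 := hz i (hrel i hi)
      rw [map_add, map_smul, this, smul_zero, add_zero, hi]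
    have := vsub_mem_vectorSpan ℝ hz' hx
    rw [vsub_eq_sub, add_sub_cancel_left] at this
    simpa [smul_smul, hε.ne'] using Submodule.smul_mem _ ε⁻¹ this

open Classical in
-- This is the relative openness of cells. A feasible direction at a relative interior point of `f`
-- along which `l₀` does not decrease stays in `f`, so `l` vanishes on it. Farkas' lemma then bounds
-- the decrease of `l` away from `f` by a multiple of that of `l₀`.
theorem exists_sub_smul_mem_normalCone {f : Face (polyhedron A b)}
    {l₀ l : StrongDual ℝ (Fin d → ℝ)} (h₀ : l₀.toExposed (polyhedron A b) = f.1)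
    (hl : l ∈ normalCone f) : ∃ ε : ℝ, 0 < ε ∧ l₀ - ε • l ∈ normalCone f := by
  obtain ⟨x, hx, hrel⟩ := f.exists_mem_relint
  let a : Option ι → (Fin d → ℝ) →ₗ[ℝ] ℝ := fun o => match o with
    | none => - (l₀ : (Fin d → ℝ) →ₗ[ℝ] ℝ)
    | some i => if A i x = b i then A i else 0
  obtain ⟨r, hr, h⟩ := exists_nonneg_combination_of_forall_nonpos Finset.univ a
    (- (l : (Fin d → ℝ) →ₗ[ℝ] ℝ)) (by
      intro z hz
      have h1 : 0 ≤ l₀ z := by simpa [a] using hz none (Finset.mem_univ _)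
      have h2 : ∀ i, A i x = b i → A i z ≤ 0 := fun i hi => by
        simpa [a, hi] using hz (some i) (Finset.mem_univ _)
      obtain ⟨ε, hε, hmem⟩ := exists_add_smul_mem_polyhedron (f.subset hx) h2
      have hmem' : x + ε • z ∈ f.1 := by
        rw [← h₀] at hx ⊢
        refine ⟨hmem, fun y hy => (hx.2 y hy).trans ?_⟩
        rw [map_add, map_smul, smul_eq_mul]
        nlinarith
      have := normalCone_apply_eq hl hmem' hx
      rw [map_add, map_smul, smul_eq_mul, add_eq_left, mul_eq_zero] at this
      simp [this.resolve_left hε.ne'])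
  have key : ∀ y ∈ polyhedron A b, r none * (l₀ y - l₀ x) ≤ l y - l x := by
    intro y hy
    have := LinearMap.congr_fun h (y - x)
    rw [Fintype.sum_option, LinearMap.add_apply, LinearMap.sum_apply] at this
    have hs : ∑ i, (r (some i) • a (some i)) (y - x) ≤ 0 := Finset.sum_nonpos fun i _ => by
      refine mul_nonpos_of_nonneg_of_nonpos (hr _) ?_
      by_cases hi : A i x = b i
      · have := hy i
        simp [a, hi, this]
      · simp [a, hi]
    simp [a] at this hs
    linarith
  have hadd : ∀ m : StrongDual ℝ (Fin d → ℝ), (∀ y ∈ polyhedron A b, m y ≤ m x) →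
      (∀ y ∈ f.1, m y = m x) → m ∈ normalCone f := fun m hm hc y hy z hz =>
    (hm z hz).trans (hc y hy).ge
  have h₀' := mem_normalCone_of_eq h₀
  -- A zero multiplier of `l₀` means that `l` is constant on the polyhedron, so `ε = 1` works;
  -- otherwise `ε` is the inverse of the multiplier.
  rcases (hr none).eq_or_lt with h0 | h0
  · refine ⟨1, one_pos, hadd _ (fun y hy => ?_) fun y hy => ?_⟩
    · have h1 := key y hy
      have h2 := h₀' x hx y hy
      have h3 := hl x hx y hy
      rw [← h0] at h1
      simp only [one_smul, sub_apply]
      linarith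
    · simp [normalCone_apply_eq hl hy hx, normalCone_apply_eq h₀' hy hx]
  · refine ⟨(r none)⁻¹, by positivity, hadd _ (fun y hy => ?_) fun y hy => ?_⟩
    · have h1 := key y hy
      rw [← le_inv_mul_iff₀ h0] at h1
      simp only [sub_apply, smul_apply, smul_eq_mul]
      linarith
    · simp [normalCone_apply_eq hl hy hx, normalCone_apply_eq h₀' hy hx]

end PolyhedronFace

/-! ### Relatively open cells of the normal fan -/

section Cell

variable {d : ℕ} {P : Set (Fin d → ℝ)}

/-- The functionals whose maximum over `P` is attained exactly on `f`. -/
def cell (f : Face P) : Set (StrongDual ℝ (Fin d → ℝ)) :=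
  {l | l.toExposed P = f.1}

/-- The functionals whose maximum over `P` is attained: the support of the normal fan. -/
def fanSupport (P : Set (Fin d → ℝ)) : Set (StrongDual ℝ (Fin d → ℝ)) :=
  {l | (l.toExposed P).Nonempty}

theorem cell_subset_normalCone (f : Face P) : cell f ⊆ normalCone f :=
  fun _ => mem_normalCone_of_eq

theorem cell_nonempty (f : Face P) : (cell f).Nonempty := f.exists_toExposed_eq

theorem mem_cell_faceOf {l : StrongDual ℝ (Fin d → ℝ)} (h : (l.toExposed P).Nonempty) :
    l ∈ cell (faceOf h) := rfl

theorem eq_of_mem_cell {f g : Face P} {l : StrongDual ℝ (Fin d → ℝ)} (hf : l ∈ cell f)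
    (hg : l ∈ cell g) : f = g :=
  Subtype.ext (Eq.trans (Eq.symm hf) hg)

theorem normalCone_subset_fanSupport (f : Face P) : normalCone f ⊆ fanSupport P := fun _ hl =>
  f.2.1.mono (mem_normalCone_iff.1 hl)

theorem cell_subset_fanSupport (f : Face P) : cell f ⊆ fanSupport P :=
  (cell_subset_normalCone f).trans (normalCone_subset_fanSupport f)

theorem add_mem_cell {f : Face P} {l m : StrongDual ℝ (Fin d → ℝ)} (hl : l ∈ cell f)
    (hm : m ∈ normalCone f) : l + m ∈ cell f := by
  have hl' : l.toExposed P = f.1 := hl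
  have hm' := mem_normalCone_iff.1 hm
  have h : l.toExposed P ∩ m.toExposed P = f.1 := by rw [hl', Set.inter_eq_left.2 hm']
  exact (toExposed_add (h ▸ f.2.1)).trans h

theorem smul_mem_cell {f : Face P} {l : StrongDual ℝ (Fin d → ℝ)} (hl : l ∈ cell f) {c : ℝ}
    (hc : 0 < c) : c • l ∈ cell f :=
  (toExposed_smul l hc).trans hl

theorem convex_cell (f : Face P) : Convex ℝ (cell f) := by
  intro l hl m hm s t hs ht hst
  rcases hs.eq_or_lt with rfl | hs
  · obtain rfl : t = 1 := by linarith
    simpa using hm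
  · exact add_mem_cell (smul_mem_cell hl hs)
      (smul_mem_normalCone (cell_subset_normalCone f hm) ht)

theorem vectorSpan_toDual_cell_le (f : Face P) :
    (vectorSpan ℝ (cell f)).map
      (LinearMap.toContinuousLinearMap (𝕜 := ℝ) (E := Fin d → ℝ) (F' := ℝ)).symm.toLinearMap ≤
      (vectorSpan ℝ f.1).dualAnnihilator := by
  rw [Submodule.map_le_iff_le_comap, vectorSpan_def, Submodule.span_le]
  rintro _ ⟨l, hl, m, hm, rfl⟩
  rw [SetLike.mem_coe, Submodule.mem_comap, Submodule.mem_dualAnnihilator]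
  intro z hz
  rw [vectorSpan_def] at hz
  induction hz using Submodule.span_induction with
  | mem z hz =>
    obtain ⟨x, hx, y, hy, rfl⟩ := hz
    have h1 := normalCone_apply_eq (cell_subset_normalCone f hl) hx hy
    have h2 := normalCone_apply_eq (cell_subset_normalCone f hm) hx hy
    simp [h1, h2]
  | zero => exact map_zero _
  | add x y _ _ hx hy => rw [map_add, hx, hy, add_zero]
  | smul c x _ hx => rw [map_smul, hx, smul_zero]

variable {ι : Type*} [Fintype ι] {A : ι → StrongDual ℝ (Fin d → ℝ)} {b : ι → ℝ}

theorem isRelOpenConvex_cell (f : Face (polyhedron A b)) : IsRelOpenConvex (cell f) := by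
  refine ⟨convex_cell f, fun l hl m hm => ?_⟩
  obtain ⟨ε, hε, h⟩ := exists_sub_smul_mem_normalCone hl (cell_subset_normalCone f hm)
  refine ⟨ε, hε, ?_⟩
  have := add_mem_cell (smul_mem_cell hl hε) h
  convert this using 1
  module

/-- The direction of the cell is the annihilator of the direction of `f`. That annihilator is
spanned by the `A i` tight on `f`, and each is a difference of two elements of the cell, because
adding `A i` does not leave it. -/
theorem finrank_vectorSpan_cell (f : Face (polyhedron A b)) :
    Module.finrank ℝ (vectorSpan ℝ (cell f)) + f.dim = d := by
  let e := (LinearMap.toContinuousLinearMap (𝕜 := ℝ) (E := Fin d → ℝ) (F' := ℝ)).symm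
  have hmap : (vectorSpan ℝ (cell f)).map e.toLinearMap = (vectorSpan ℝ f.1).dualAnnihilator := by
    refine le_antisymm (vectorSpan_toDual_cell_le f) fun m hm => ?_
    obtain ⟨l, hl⟩ := cell_nonempty f
    have hA : ∀ i ∈ {i | ∀ y ∈ f.1, A i y = b i}, A i ∈ vectorSpan ℝ (cell f) := by
      intro i hi
      have hN : A i ∈ normalCone f := fun x hx y hy => (hy i).trans (hi x hx).ge
      have := vsub_mem_vectorSpan ℝ (add_mem_cell hl hN) hl
      simpa using this
    have hspan : m ∈ Submodule.span ℝ (Set.range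
        fun i : {i | ∀ y ∈ f.1, A i y = b i} => (A i : (Fin d → ℝ) →ₗ[ℝ] ℝ)) := by
      refine mem_span_of_iInf_ker_le_ker fun z hz => ?_
      rw [Submodule.mem_dualAnnihilator] at hm
      refine hm z ?_
      rw [f.vectorSpan_eq]
      rw [iInf_subtype] at hz
      exact hz
    refine Submodule.span_le.2 ?_ hspan
    rintro _ ⟨i, rfl⟩
    exact ⟨A i, hA i i.2, rfl⟩
  have h1 : Module.finrank ℝ ((vectorSpan ℝ (cell f)).map e.toLinearMap) =
      Module.finrank ℝ (vectorSpan ℝ (cell f)) := LinearEquiv.finrank_map_eq e _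
  have h2 := Subspace.finrank_add_finrank_dualAnnihilator_eq (vectorSpan ℝ f.1)
  rw [← hmap, h1, Module.finrank_fin_fun] at h2
  rw [Face.dim, add_comm]
  exact h2

theorem finrank_vectorSpan_cell_inter (f : Face (polyhedron A b))
    {U : Set (StrongDual ℝ (Fin d → ℝ))} (hU : IsOpen U) (hc : Convex ℝ U)
    (hne : (cell f ∩ U).Nonempty) :
    Module.finrank ℝ (vectorSpan ℝ (cell f ∩ U)) + f.dim = d := by
  refine Eq.trans ?_ (finrank_vectorSpan_cell f)
  rw [(isRelOpenConvex_cell f).vectorSpan_inter (IsRelOpenConvex.of_isOpen hU hc) hne]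
  have : vectorSpan ℝ U = ⊤ := by
    have := (hU.affineSpan_eq_top (hne.mono Set.inter_subset_right) : affineSpan ℝ U = ⊤)
    rw [← direction_affineSpan, this, AffineSubspace.direction_top]
  rw [this, inf_top_eq]

/-! ### The support of the normal fan and its interior. -/

theorem mem_fanSupport_iff (hne : (polyhedron A b).Nonempty) {l : StrongDual ℝ (Fin d → ℝ)} :
    l ∈ fanSupport (polyhedron A b) ↔ ∃ M, ∀ x ∈ polyhedron A b, l x ≤ M := by
  constructor
  · rintro ⟨x, hx⟩
    exact ⟨l x, hx.2⟩
  · rintro ⟨M, hM⟩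
    refine toExposed_polyhedron_nonempty hne l ⟨M, ?_⟩
    rintro _ ⟨x, hx, rfl⟩
    exact hM x hx

theorem add_mem_fanSupport {l m : StrongDual ℝ (Fin d → ℝ)}
    (hl : l ∈ fanSupport (polyhedron A b)) (hm : m ∈ fanSupport (polyhedron A b)) :
    l + m ∈ fanSupport (polyhedron A b) := by
  have hne : (polyhedron A b).Nonempty := hl.mono fun _ h => h.1
  rw [mem_fanSupport_iff hne] at *
  obtain ⟨M, hM⟩ := hl
  obtain ⟨N, hN⟩ := hm
  exact ⟨M + N, fun x hx => add_le_add (hM x hx) (hN x hx)⟩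

theorem smul_mem_fanSupport {P : Set (Fin d → ℝ)} {l : StrongDual ℝ (Fin d → ℝ)}
    (hl : l ∈ fanSupport P) {c : ℝ} (hc : 0 < c) : c • l ∈ fanSupport P := by
  have : (l.toExposed P).Nonempty := hl
  rwa [← toExposed_smul l hc] at this

theorem coeff_mem_fanSupport (hne : (polyhedron A b).Nonempty) (i : ι) :
    A i ∈ fanSupport (polyhedron A b) :=
  (mem_fanSupport_iff hne).2 ⟨b i, fun _ hx => hx i⟩

theorem smul_add_mem_interior_fanSupport {l m : StrongDual ℝ (Fin d → ℝ)}
    (hl : l ∈ fanSupport (polyhedron A b)) (hm : m ∈ interior (fanSupport (polyhedron A b)))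
    {c : ℝ} (hc : 0 < c) : l + c • m ∈ interior (fanSupport (polyhedron A b)) := by
  rw [mem_interior] at hm ⊢
  obtain ⟨U, hU, hUo, hmU⟩ := hm
  refine ⟨(fun x => c⁻¹ • (x - l)) ⁻¹' U, fun x hx => ?_, hUo.preimage (by fun_prop), ?_⟩
  · have := add_mem_fanSupport hl (smul_mem_fanSupport (hU hx) hc)
    rwa [smul_smul, mul_inv_cancel₀ hc.ne', one_smul, add_sub_cancel] at this
  · simpa [smul_smul, hc.ne'] using hmU

/-- By relative openness any `m` in the cell is `(m - ε • l) + ε • l`, the sum of an element of the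
support and one of its interior. Hence the interior of the support is a union of cells. -/
theorem cell_subset_interior_of_mem {f : Face (polyhedron A b)} {l : StrongDual ℝ (Fin d → ℝ)}
    (hl : l ∈ cell f) (hi : l ∈ interior (fanSupport (polyhedron A b))) :
    cell f ⊆ interior (fanSupport (polyhedron A b)) := by
  intro m hm
  obtain ⟨ε, hε, h⟩ := exists_sub_smul_mem_normalCone hm (cell_subset_normalCone f hl)
  simpa using smul_add_mem_interior_fanSupport (normalCone_subset_fanSupport f h) hi hε

theorem convex_fanSupport : Convex ℝ (fanSupport (polyhedron A b)) := by
  intro l hl m hm s t hs ht hst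
  rcases hs.eq_or_lt with rfl | hs
  · obtain rfl : t = 1 := by linarith
    simpa using hm
  rcases ht.eq_or_lt with rfl | ht
  · obtain rfl : s = 1 := by linarith
    simpa using hl
  exact add_mem_fanSupport (smul_mem_fanSupport hl hs) (smul_mem_fanSupport hm ht)

theorem Vertex.dim_face {P : Set (Fin d → ℝ)} (v : Vertex P) : v.face.dim = 0 := by
  rw [Face.dim, show v.face.1 = {v.1} from rfl, vectorSpan_singleton, finrank_bot]

/-- The cell of a vertex has full dimension, so it contains an interior point of the support. -/
theorem cell_vertex_subset_interior (v : Vertex (polyhedron A b)) :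
    cell v.face ⊆ interior (fanSupport (polyhedron A b)) := by
  have hfin := finrank_vectorSpan_cell v.face
  rw [v.dim_face, add_zero] at hfin
  have htop : vectorSpan ℝ (cell v.face) = ⊤ := by
    apply Submodule.eq_top_of_finrank_eq
    rw [hfin, ← (LinearMap.toContinuousLinearMap (𝕜 := ℝ) (E := Fin d → ℝ) (F' := ℝ)).finrank_eq]
    have := Subspace.dual_finrank_eq (K := ℝ) (V := Fin d → ℝ)
    rw [Module.finrank_fin_fun] at this
    exact this.symm
  have haff : affineSpan ℝ (cell v.face) = ⊤ := by
    rw [AffineSubspace.affineSpan_eq_top_iff_vectorSpan_eq_top_of_nonempty ℝ _ _ (cell_nonempty _)]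
    exact htop
  obtain ⟨l, hl⟩ := (convex_cell v.face).interior_nonempty_iff_affineSpan_eq_top.2 haff
  exact cell_subset_interior_of_mem (interior_subset hl)
    (interior_mono (cell_subset_fanSupport _) hl)

end Cell

/-! ### Degenerations and the face map -/

section Degeneration

variable {d : ℕ} {P Q : Set (Fin d → ℝ)}

/-- `Q` is a limit of polyhedra with the normal fan of `P`. -/
def IsFanLimit (P Q : Set (Fin d → ℝ)) : Prop :=
  ∀ ε : ℝ, 0 < ε → ∃ S : Set (Fin d → ℝ), IsPolyhedron S ∧ normalFan P = normalFan S ∧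
    (∀ x ∈ S, ∃ y ∈ Q, dist x y < ε) ∧ ∀ y ∈ Q, ∃ x ∈ S, dist x y < ε

/-- Of the deformation only the behaviour for `α → 1` from below is retained. -/
theorem IsDegeneration.isFanLimit (h : IsDegeneration P Q) : IsFanLimit P Q := by
  obtain ⟨S, -, rfl, hlim, hS⟩ := h
  intro ε hε
  have h1 := hlim 1 (Set.right_mem_Icc.2 zero_le_one)
  have h2 := (h1.mono_left (nhdsWithin_mono 1 Set.Ico_subset_Icc_self)).eventually
    (gt_mem_nhds (ENNReal.ofReal_pos.2 hε))
  have : (𝓝[Set.Ico (0 : ℝ) 1] 1).NeBot := by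
    rw [← mem_closure_iff_nhdsWithin_neBot, closure_Ico zero_ne_one]
    exact Set.right_mem_Icc.2 zero_le_one
  obtain ⟨α, hα, hmem⟩ := (h2.and self_mem_nhdsWithin).exists
  refine ⟨S α, (hS α hmem).1, (hS α hmem).2, fun x hx => ?_, fun y hy => ?_⟩
  · obtain ⟨y, hy, hxy⟩ := Metric.exists_edist_lt_of_hausdorffEDist_lt hx hα
    exact ⟨y, hy, edist_lt_ofReal.1 hxy⟩
  · rw [Metric.hausdorffEDist_comm] at hα
    obtain ⟨x, hx, hxy⟩ := Metric.exists_edist_lt_of_hausdorffEDist_lt hy hα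
    exact ⟨x, hx, by rw [dist_comm]; exact edist_lt_ofReal.1 hxy⟩

theorem nonempty_iff_nonempty_face : P.Nonempty ↔ Nonempty (Face P) :=
  ⟨fun h => ⟨⟨P, h, IsExposed.refl P⟩⟩, fun ⟨f⟩ => f.2.1.mono f.subset⟩

theorem normalFan_nonempty : (normalFan P).Nonempty ↔ P.Nonempty := by
  rw [normalFan, Set.range_nonempty_iff_nonempty, nonempty_iff_nonempty_face]

theorem fanSupport_eq_sUnion : fanSupport P = ⋃₀ normalFan P := by
  ext l
  constructor
  · exact fun h => ⟨_, ⟨faceOf h, rfl⟩, cell_subset_normalCone _ (mem_cell_faceOf h)⟩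
  · rintro ⟨_, ⟨f, rfl⟩, hl⟩
    exact normalCone_subset_fanSupport f hl

theorem abs_apply_sub_le (l : StrongDual ℝ (Fin d → ℝ)) {x y : Fin d → ℝ} {ε : ℝ}
    (h : dist x y < ε) : |l x - l y| ≤ ‖l‖ * ε := by
  rw [← map_sub, ← Real.norm_eq_abs]
  refine (l.le_opNorm _).trans (mul_le_mul_of_nonneg_left ?_ (norm_nonneg _))
  rw [← dist_eq_norm]
  exact h.le

theorem IsFanLimit.nonempty_iff (h : IsFanLimit P Q) : P.Nonempty ↔ Q.Nonempty := by
  obtain ⟨S, -, hfan, h1, h2⟩ := h 1 one_pos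
  rw [← normalFan_nonempty, hfan, normalFan_nonempty]
  constructor
  · rintro ⟨x, hx⟩
    obtain ⟨y, hy, -⟩ := h1 x hx
    exact ⟨y, hy⟩
  · rintro ⟨y, hy⟩
    obtain ⟨x, hx, -⟩ := h2 y hy
    exact ⟨x, hx⟩

/-- The support consists of the functionals bounded above, and boundedness is the same on two sets
at finite Hausdorff distance. -/
theorem IsFanLimit.fanSupport_eq (h : IsFanLimit P Q) (hQ : IsPolyhedron Q) (hne : Q.Nonempty) :
    fanSupport P = fanSupport Q := by
  obtain ⟨S, hS, hfan, h1, h2⟩ := h 1 one_pos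
  rw [fanSupport_eq_sUnion, hfan, ← fanSupport_eq_sUnion]
  have hSne : S.Nonempty := by
    obtain ⟨y, hy⟩ := hne
    obtain ⟨x, hx, -⟩ := h2 y hy
    exact ⟨x, hx⟩
  obtain ⟨m, A, b, rfl⟩ := hS.exists_eq_polyhedron
  obtain ⟨m', A', b', rfl⟩ := hQ.exists_eq_polyhedron
  ext l
  rw [mem_fanSupport_iff hne, mem_fanSupport_iff hSne]
  constructor
  · rintro ⟨M, hM⟩
    refine ⟨M + ‖l‖ * 1, fun y hy => ?_⟩
    obtain ⟨x, hx, hxy⟩ := h2 y hy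
    have := abs_le.1 (abs_apply_sub_le l hxy)
    have := hM x hx
    linarith
  · rintro ⟨M, hM⟩
    refine ⟨M + ‖l‖ * 1, fun x hx => ?_⟩
    obtain ⟨y, hy, hxy⟩ := h1 x hx
    have := abs_le.1 (abs_apply_sub_le l hxy)
    have := hM y hy
    linarith

/-- On an approximating polyhedron `l` and `m` attain their maxima at a common point. A maximiser of
`l + m` over `Q` is therefore nearly maximal for `l`, and the error tends to zero. -/
theorem IsFanLimit.toExposed_add_subset (h : IsFanLimit P Q) {f : Face P}
    {l m : StrongDual ℝ (Fin d → ℝ)} (hl : l ∈ normalCone f) (hm : m ∈ normalCone f) :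
    (l + m).toExposed Q ⊆ l.toExposed Q := by
  rintro y ⟨hy, hmax⟩
  refine ⟨hy, fun z hz => ?_⟩
  refine le_of_forall_pos_le_add fun δ hδ => ?_
  have hpos : 0 < ‖l‖ + ‖m‖ + ‖l + m‖ + 1 := by positivity
  -- The three approximations below cost `‖l + m‖`, `‖m‖` and `‖l‖` times the tolerance; the `1`
  -- only keeps the denominator positive.
  obtain ⟨S, -, hfan, h1, h2⟩ := h (δ / (‖l‖ + ‖m‖ + ‖l + m‖ + 1)) (by positivity)
  have hf : normalCone f ∈ normalFan S := hfan ▸ ⟨f, rfl⟩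
  obtain ⟨g, hg⟩ := hf
  rw [← hg] at hl hm
  obtain ⟨x, hx⟩ := g.2.1
  obtain ⟨x', hx', hxx'⟩ := h1 x (g.subset hx)
  obtain ⟨y', hy', hyy'⟩ := h2 y hy
  obtain ⟨z', hz', hzz'⟩ := h2 z hz
  have e1 := (abs_le.1 (abs_apply_sub_le (l + m) hxx')).2
  have e2 := (abs_le.1 (abs_apply_sub_le m hyy')).1
  have e3 := (abs_le.1 (abs_apply_sub_le l hzz')).1
  have i1 := hmax x' hx'
  have i2 := hl x hx z' hz'
  have i3 := hm x hx y' hy'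
  have hδ' : (‖l‖ + ‖m‖ + ‖l + m‖) * (δ / (‖l‖ + ‖m‖ + ‖l + m‖ + 1)) ≤ δ := by
    rw [← mul_div_assoc, div_le_iff₀ hpos]
    nlinarith
  simp only [add_apply] at e1 i1
  linarith

variable {ι : Type*} [Fintype ι] {A : ι → StrongDual ℝ (Fin d → ℝ)} {b : ι → ℝ}

theorem IsFanLimit.toExposed_subset (h : IsFanLimit (polyhedron A b) Q)
    {f : Face (polyhedron A b)} {l₀ l : StrongDual ℝ (Fin d → ℝ)} (h₀ : l₀ ∈ cell f)
    (hl : l ∈ normalCone f) : l₀.toExposed Q ⊆ l.toExposed Q := by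
  obtain ⟨ε, hε, hm⟩ := exists_sub_smul_mem_normalCone h₀ hl
  have := h.toExposed_add_subset (smul_mem_normalCone hl hε.le) hm
  rwa [add_sub_cancel, toExposed_smul l hε] at this

/-- `π f` is the face of `Q` exposed by any functional `l₀` in the cell of `f`: every normal cone of
`Q` that contains `l₀` contains the cone of this face. -/
theorem IsFanLimit.exists_isInducedFaceMap (h : IsFanLimit (polyhedron A b) Q)
    (hQ : IsPolyhedron Q) : ∃ π : Face (polyhedron A b) → Face Q, IsInducedFaceMap π := by
  choose l hl using fun f : Face (polyhedron A b) => cell_nonempty f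
  have hne : ∀ f : Face (polyhedron A b), ((l f).toExposed Q).Nonempty := by
    intro f
    have hQne : Q.Nonempty := h.nonempty_iff.1 (nonempty_iff_nonempty_face.2 ⟨f⟩)
    have := cell_subset_fanSupport f (hl f)
    rwa [h.fanSupport_eq hQ hQne] at this
  refine ⟨fun f => faceOf (hne f), fun f => ⟨fun m hm => ?_, fun g hg => ?_⟩⟩
  · exact mem_normalCone_iff.2 (h.toExposed_subset (hl f) hm)
  · exact normalCone_subset_iff.2 (mem_normalCone_iff.1 (hg (cell_subset_normalCone f (hl f))))

theorem IsInducedFaceMap.unique {P Q : Set (Fin d → ℝ)} {π π' : Face P → Face Q}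
    (h : IsInducedFaceMap π) (h' : IsInducedFaceMap π') : π = π' :=
  funext fun f => normalCone_injective
    (((h f).2 _ (h' f).1).antisymm ((h' f).2 _ (h f).1))

/-- This is the refinement of fans in the form used below: each cell for `P` lies in the cell of the
image face. -/
theorem IsInducedFaceMap.mem_cell {π : Face (polyhedron A b) → Face Q} (hπ : IsInducedFaceMap π)
    (h : IsFanLimit (polyhedron A b) Q) {f : Face (polyhedron A b)}
    {l : StrongDual ℝ (Fin d → ℝ)} (hl : l ∈ cell f) : l ∈ cell (π f) := by
  have hsub : (π f).1 ⊆ l.toExposed Q :=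
    mem_normalCone_iff.1 ((hπ f).1 (cell_subset_normalCone f hl))
  refine Set.Subset.antisymm ?_ hsub
  exact normalCone_subset_iff.1 ((hπ f).2 (faceOf ((π f).2.1.mono hsub)) fun m hm =>
    mem_normalCone_iff.2 (h.toExposed_subset hl hm))

theorem IsInducedFaceMap.mono {P Q : Set (Fin d → ℝ)} {π : Face P → Face Q}
    (hπ : IsInducedFaceMap π) {f g : Face P} (hfg : f.1 ⊆ g.1) : (π f).1 ⊆ (π g).1 :=
  normalCone_subset_iff.1 ((hπ g).2 _ ((normalCone_antitone hfg).trans (hπ f).1))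

/-- The inequalities of `P` tight at `v` belong to the normal cone of `π v`, so they are constant on
`π v`; their common kernel is zero. -/
theorem IsInducedFaceMap.exists_vertex {π : Face (polyhedron A b) → Face Q}
    (hπ : IsInducedFaceMap π) (v : Vertex (polyhedron A b)) :
    ∃ v' : Vertex Q, π v.face = v'.face := by
  obtain ⟨y, hy⟩ := (π v.face).2.1
  have hsing : (π v.face).1 = {y} := by
    refine Set.eq_singleton_iff_unique_mem.2 ⟨hy, fun x hx => ?_⟩
    have hz : x - y ∈ vectorSpan ℝ v.face.1 := by
      rw [v.face.vectorSpan_eq]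
      simp only [Submodule.mem_iInf, LinearMap.mem_ker]
      intro i hi
      have hA : A i ∈ normalCone v.face := fun x hx z hz => (hz i).trans (hi x hx).ge
      have := normalCone_apply_eq ((hπ _).1 hA) hx hy
      simp [this]
    rw [show v.face.1 = {v.1} from rfl, vectorSpan_singleton, Submodule.mem_bot, sub_eq_zero] at hz
    exact hz
  exact ⟨⟨y, hsing ▸ (π v.face).2.2⟩, Subtype.ext hsing⟩

end Degeneration

/-! ### Euler relations for the cells of a normal fan -/

/-- The Euler relation, with `D` as an extra set of weight `-1`. -/
theorem IsRelOpenConvex.sum_neg_one_pow_finrank_of_partition {V : Type*} [AddCommGroup V]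
    [Module ℝ V] [FiniteDimensional ℝ V] {ι : Type*} (s : Finset ι) (C : ι → Set V) {D : Set V}
    (hC : ∀ i ∈ s, IsRelOpenConvex (C i)) (hne : ∀ i ∈ s, (C i).Nonempty)
    (hD : IsRelOpenConvex D) (hDne : D.Nonempty) (hcover : D = ⋃ i ∈ s, C i)
    (hdisj : ∀ i ∈ s, ∀ j ∈ s, ∀ x ∈ C i, x ∈ C j → i = j) :
    ∑ i ∈ s, (-1 : ℤ) ^ Module.finrank ℝ (vectorSpan ℝ (C i)) =
      (-1) ^ Module.finrank ℝ (vectorSpan ℝ D) := by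
  classical
  have h := sum_neg_one_pow_finrank_eq_zero (Finset.insertNone s)
    (fun o => o.elim D C) (fun o => o.elim (-1) fun _ => 1) ?_ ?_ ?_
  · rw [Finset.sum_insertNone] at h
    have h' : -1 * (-1 : ℤ) ^ Module.finrank ℝ (vectorSpan ℝ D) +
        ∑ i ∈ s, 1 * (-1 : ℤ) ^ Module.finrank ℝ (vectorSpan ℝ (C i)) = 0 := h
    simp only [one_mul] at h'
    linarith
  · rintro (_ | i) hi
    · exact hD
    · exact hC i (by simpa using hi)
  · rintro (_ | i) hi
    · exact hDne
    · exact hne i (by simpa using hi)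
  · intro x
    rw [Finset.sum_insertNone]
    by_cases hx : x ∈ D
    · obtain ⟨i, hi, hxi⟩ : ∃ i ∈ s, x ∈ C i := by simpa [hcover] using hx
      rw [if_pos (show x ∈ Option.elim none D C from hx), Finset.sum_eq_single_of_mem i hi,
        if_pos (show x ∈ Option.elim (some i) D C from hxi)]
      · rfl
      · exact fun j hj hji => if_neg fun hxj => hji (hdisj j hj i hi x hxj hxi)
    · rw [if_neg (show x ∉ Option.elim none D C from hx), zero_add]
      refine Finset.sum_eq_zero fun i hi => if_neg fun hxi => hx ?_
      rw [hcover]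
      exact Set.mem_biUnion hi hxi

theorem exists_add_smul_mem_of_isOpen {V : Type*} [AddCommGroup V] [Module ℝ V]
    [TopologicalSpace V] [IsTopologicalAddGroup V] [ContinuousSMul ℝ V] {U : Set V}
    (hU : IsOpen U) {x : V} (hx : x ∈ U) (v : V) : ∃ c : ℝ, 0 < c ∧ x + c • v ∈ U := by
  have hc : Continuous fun ε : ℝ => x + ε • v := by fun_prop
  have := (hc.tendsto 0).eventually (hU.mem_nhds (by simpa using hx))
  obtain ⟨c, h, hc⟩ := ((this.filter_mono nhdsWithin_le_nhds).and
    (self_mem_nhdsWithin : Set.Ioi (0 : ℝ) ∈ 𝓝[>] 0)).exists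
  exact ⟨c, hc, h⟩

section

variable {d : ℕ}

/-- The cells of the subfaces of `f` accumulate at every functional exposing `f`. -/
theorem exists_mem_cell_inter {P : Set (Fin d → ℝ)} {f g : Face P} (hgf : g.1 ⊆ f.1)
    {l₀ : StrongDual ℝ (Fin d → ℝ)} (h₀ : l₀ ∈ cell f) {U : Set (StrongDual ℝ (Fin d → ℝ))}
    (hU : IsOpen U) (hl₀ : l₀ ∈ U) {l : StrongDual ℝ (Fin d → ℝ)} (hl : l ∈ cell g) :
    ∃ c : ℝ, 0 < c ∧ l₀ + c • l ∈ cell g ∩ U := by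
  obtain ⟨c, hc, hcU⟩ := exists_add_smul_mem_of_isOpen hU hl₀ l
  refine ⟨c, hc, ?_, hcU⟩
  rw [add_comm]
  exact add_mem_cell (smul_mem_cell hl hc)
    (normalCone_antitone hgf (cell_subset_normalCone f h₀))

variable {ι : Type*} [Fintype ι] {A : ι → StrongDual ℝ (Fin d → ℝ)} {b : ι → ℝ}

/-- Cells have the complementary dimension of their faces, so the common factor `(-1) ^ d` cancels.
-/
theorem sum_neg_one_pow_dim_of_partition (s : Finset (Face (polyhedron A b)))
    {U D : Set (StrongDual ℝ (Fin d → ℝ))} (hU : IsOpen U) (hc : Convex ℝ U)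
    (hne : ∀ g ∈ s, (cell g ∩ U).Nonempty) (hD : IsRelOpenConvex D) (hDne : D.Nonempty) {k : ℕ}
    (hk : Module.finrank ℝ (vectorSpan ℝ D) + k = d) (hcover : D = ⋃ g ∈ s, cell g ∩ U) :
    ∑ g ∈ s, (-1 : ℤ) ^ g.dim = (-1) ^ k := by
  have h := IsRelOpenConvex.sum_neg_one_pow_finrank_of_partition s (fun g => cell g ∩ U)
    (fun g _ => (isRelOpenConvex_cell g).inter (IsRelOpenConvex.of_isOpen hU hc)) hne hD hDne
    hcover (fun g _ g' _ l hl hl' => eq_of_mem_cell hl.1 hl'.1)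
  have hsign : ∀ a k : ℕ, a + k = d → (-1 : ℤ) ^ a = (-1) ^ d * (-1) ^ k := by
    rintro a k rfl
    rw [pow_add, mul_assoc, ← mul_pow]
    simp
  rw [hsign _ _ hk, Finset.sum_congr rfl fun g hg =>
    hsign _ _ (finrank_vectorSpan_cell_inter g hU hc (hne g hg)), ← Finset.mul_sum] at h
  exact mul_left_cancel₀ (by simp) h

theorem exists_mem_cell {P : Set (Fin d → ℝ)} {l : StrongDual ℝ (Fin d → ℝ)}
    (h : l ∈ fanSupport P) : ∃ g : Face P, l ∈ cell g :=
  ⟨faceOf h, rfl⟩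

theorem isClosed_normalCone {P : Set (Fin d → ℝ)} (f : Face P) : IsClosed (normalCone f) := by
  have : normalCone f = ⋂ x ∈ f.1, ⋂ y ∈ P, {l | l y ≤ l x} := by
    ext l
    simp [normalCone]
  rw [this]
  exact isClosed_biInter fun x _ => isClosed_biInter fun y _ =>
    isClosed_le (by fun_prop) (by fun_prop)

/-- The normal cones of the faces not contained in `f` are finitely many closed sets that miss `l₀`,
so a ball around `l₀` avoids them. -/
theorem exists_isOpen_forall_subset {f : Face (polyhedron A b)}
    {l₀ : StrongDual ℝ (Fin d → ℝ)} (h₀ : l₀ ∈ cell f) :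
    ∃ U : Set (StrongDual ℝ (Fin d → ℝ)), IsOpen U ∧ Convex ℝ U ∧ l₀ ∈ U ∧
      ∀ l ∈ U, ∀ g : Face (polyhedron A b), l ∈ normalCone g → g.1 ⊆ f.1 := by
  have := finite_face (A := A) (b := b)
  have hclosed : IsClosed (⋃ g ∈ {g : Face (polyhedron A b) | ¬ g.1 ⊆ f.1}, normalCone g) :=
    (Set.toFinite _).isClosed_biUnion fun g _ => isClosed_normalCone g
  have hmem : l₀ ∈ (⋃ g ∈ {g : Face (polyhedron A b) | ¬ g.1 ⊆ f.1}, normalCone g)ᶜ := by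
    simp only [Set.mem_compl_iff, Set.mem_iUnion, not_exists]
    intro g hg hl
    have h₀' : l₀.toExposed (polyhedron A b) = f.1 := h₀
    exact hg (h₀' ▸ mem_normalCone_iff.1 hl)
  obtain ⟨ε, hε, hball⟩ := Metric.isOpen_iff.1 hclosed.isOpen_compl l₀ hmem
  refine ⟨Metric.ball l₀ ε, Metric.isOpen_ball, convex_ball _ _, Metric.mem_ball_self hε,
    fun l hl g hg => ?_⟩
  by_contra hgf
  exact hball hl (Set.mem_biUnion hgf hg)

variable {κ : Type*} [Fintype κ] {A' : κ → StrongDual ℝ (Fin d → ℝ)} {b' : κ → ℝ}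
  {π : Face (polyhedron A b) → Face (polyhedron A' b')}

theorem isPolyhedron_polyhedron : IsPolyhedron (polyhedron A b) := by
  classical
  let e := (Fintype.equivFin ι).symm
  refine ⟨Fintype.card ι, fun i j => A (e i) (Pi.single j 1), fun i => b (e i), ?_⟩
  ext x
  have hA : ∀ i, A i x = ∑ j, A i (Pi.single j 1) * x j := fun i => by
    conv_lhs => rw [pi_eq_sum_univ' x]
    simp [mul_comm]
  simp only [polyhedron, Set.mem_ofPred_eq, ← hA]
  exact e.forall_congr_right.symm

open Classical in
-- Near a functional exposing `f`, the cell of `f'` is partitioned by the cells of the faces `g ⊆ f`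
-- with `π g = f'`. The hypothesis on `f'` ensures that its cell reaches this neighbourhood.
theorem IsInducedFaceMap.sum_fiber [Fintype (Face (polyhedron A b))] (hπ : IsInducedFaceMap π)
    (h : IsFanLimit (polyhedron A b) (polyhedron A' b')) (f : Face (polyhedron A b))
    {f' : Face (polyhedron A' b')} (hf' : f'.1 ⊆ (π f).1) :
    ∑ g with g.1 ⊆ f.1 ∧ π g = f', (-1 : ℤ) ^ g.dim = (-1) ^ f'.dim := by
  obtain ⟨l₀, h₀⟩ := cell_nonempty f
  obtain ⟨U, hU, hc, hl₀, hUf⟩ := exists_isOpen_forall_subset h₀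
  have hsupp := h.fanSupport_eq isPolyhedron_polyhedron
    (nonempty_iff_nonempty_face.2 ⟨f'⟩)
  obtain ⟨l', hl'⟩ := cell_nonempty f'
  obtain ⟨c', -, hmem'⟩ := exists_mem_cell_inter hf' (hπ.mem_cell h h₀) hU hl₀ hl'
  refine sum_neg_one_pow_dim_of_partition _ hU hc (fun g hg => ?_)
    ((isRelOpenConvex_cell f').inter (IsRelOpenConvex.of_isOpen hU hc)) ⟨_, hmem'⟩
    (finrank_vectorSpan_cell_inter f' hU hc ⟨_, hmem'⟩) ?_
  · obtain ⟨l, hl⟩ := cell_nonempty g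
    obtain ⟨c, -, hmem⟩ := exists_mem_cell_inter (Finset.mem_filter.1 hg).2.1 h₀ hU hl₀ hl
    exact ⟨_, hmem⟩
  · ext l
    simp only [Set.mem_iUnion, Finset.mem_filter_univ, exists_prop]
    constructor
    · rintro ⟨hl, hlU⟩
      have hls : l ∈ fanSupport (polyhedron A b) := hsupp ▸ cell_subset_fanSupport f' hl
      obtain ⟨g, hlg⟩ := exists_mem_cell hls
      exact ⟨g, ⟨hUf l hlU _ (cell_subset_normalCone _ hlg),
        eq_of_mem_cell (hπ.mem_cell h hlg) hl⟩, hlg, hlU⟩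
    · rintro ⟨g, ⟨-, rfl⟩, hl, hlU⟩
      exact ⟨hπ.mem_cell h hl, hlU⟩

/-- The degeneration of the tangent cone of the face `f` at its face `g`: its inequalities are
those of the cone, moved to the face `π g`. -/
def shiftedCone {P Q : Set (Fin d → ℝ)} (π : Face P → Face Q) (f g : Face P) :
    Set (Fin d → ℝ) :=
  {x | (∀ l ∈ normalCone g, ∀ y ∈ (π g).1, l x ≤ l y) ∧
    ∀ l ∈ normalCone f, ∀ y ∈ (π g).1, l x = l y}

open Classical in
/-- The Brianchon-Gram relation for a degeneration; the faces that contribute are the bounded ones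
and only these have their cell in the interior of the support of the normal fan. -/
theorem IsInducedFaceMap.sum_shiftedCone [Fintype (Face (polyhedron A b))]
    (hπ : IsInducedFaceMap π) (h : IsFanLimit (polyhedron A b) (polyhedron A' b'))
    (hΩ : (interior (fanSupport (polyhedron A b))).Nonempty) (f : Face (polyhedron A b))
    (x : Fin d → ℝ) :
    ∑ g with g.1 ⊆ f.1 ∧ cell g ⊆ interior (fanSupport (polyhedron A b)),
      (if x ∈ shiftedCone π f g then (-1 : ℤ) ^ g.dim else 0) =
        if x ∈ (π f).1 then 1 else 0 := by
  set Ω := interior (fanSupport (polyhedron A b)) with hΩdef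
  -- The equations of `f`, moved to `π f`, hold on `π f` and on all the cones involved; where they
  -- fail, both sides vanish.
  by_cases hx : ∀ l ∈ normalCone f, ∀ y ∈ (π f).1, l x = l y
  swap
  · rw [if_neg fun hxf => hx fun l hl y hy => normalCone_apply_eq ((hπ f).1 hl) hxf hy]
    refine Finset.sum_eq_zero fun g hg => if_neg fun hxg => hx fun l hl y hy => ?_
    obtain ⟨z, hz⟩ := (π g).2.1
    rw [hxg.2 l hl z hz]
    exact normalCone_apply_eq ((hπ f).1 hl) (hπ.mono (Finset.mem_filter.1 hg).2.1 hz) hy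
  obtain ⟨l₀, h₀⟩ := cell_nonempty f
  obtain ⟨U, hU, hc, hl₀, hUf⟩ := exists_isOpen_forall_subset h₀
  have hsupp := h.fanSupport_eq isPolyhedron_polyhedron
    (nonempty_iff_nonempty_face.2 ⟨π f⟩)
  choose y hy using fun g : Face (polyhedron A b) => (π g).2.1
  -- `y g` maximises the functionals of the cone of `g` over `Q`. Hence, inside the support, `W`
  -- consists of the functionals larger at `x` than anywhere on `Q`; being defined by finitely many
  -- strict inequalities it is open.
  let W : Set (StrongDual ℝ (Fin d → ℝ)) := {l | ∀ g, l (y g) < l x}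
  have hWeq : W = ⋂ g, {l | l (y g) < l x} := by
    ext l
    simp [W]
  have hWo : IsOpen W := by
    rw [hWeq]
    exact isOpen_iInter_of_finite fun g => isOpen_lt (by fun_prop) (by fun_prop)
  have hWc : Convex ℝ W := by
    intro l hl m hm s t hs ht hst g
    have h1 := hl g
    have h2 := hm g
    simp only [add_apply, smul_apply, smul_eq_mul]
    rcases hs.eq_or_lt with rfl | hs
    · obtain rfl : t = 1 := by linarith
      linarith
    · have := mul_lt_mul_of_pos_left h1 hs
      have := mul_le_mul_of_nonneg_left h2.le ht
      linarith
  have hcellW : ∀ g, ∀ l ∈ cell g, (l ∈ W ↔ l (y g) < l x) := fun g l hl =>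
    ⟨fun hW => hW g, fun hlt g' =>
      ((hπ g).1 (cell_subset_normalCone g hl) _ (hy g) _ ((π g').subset (hy g'))).trans_lt hlt⟩
  -- A functional of the cone of `g` violated by `x` is perturbed into the cell and then added, with
  -- a small factor, to `l₀`. As `l₀` takes the same value at `x` and `y g`, the violation persists.
  have hK : ∀ g : Face (polyhedron A b), g.1 ⊆ f.1 →
      (x ∈ shiftedCone π f g ↔ ¬ (cell g ∩ (U ∩ W)).Nonempty) := by
    intro g hgf
    constructor
    · rintro hxg ⟨l, hl, -, hlW⟩
      exact absurd (hxg.1 l (cell_subset_normalCone g hl) _ (hy g)) (not_le.2 (hlW g))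
    · intro hempty
      refine ⟨fun l hl z hz => ?_, fun l hl z hz => hx l hl z (hπ.mono hgf hz)⟩
      by_contra! hlt
      rw [normalCone_apply_eq ((hπ g).1 hl) hz (hy g)] at hlt
      obtain ⟨m, hm⟩ := cell_nonempty g
      obtain ⟨δ, hδ, hmem⟩ := exists_add_smul_mem_of_isOpen
        (U := {l : StrongDual ℝ (Fin d → ℝ) | l (y g) < l x})
        (isOpen_lt (by fun_prop) (by fun_prop)) hlt m
      have hn : l + δ • m ∈ cell g := by
        rw [add_comm]
        exact add_mem_cell (smul_mem_cell hm hδ) hl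
      obtain ⟨c, hc, hcell⟩ := exists_mem_cell_inter hgf h₀ hU hl₀ hn
      refine hempty ⟨_, hcell.1, hcell.2, (hcellW g _ hcell.1).2 ?_⟩
      have h1 := hx l₀ (cell_subset_normalCone f h₀) _ (hπ.mono hgf (hy g))
      have h2 := mul_lt_mul_of_pos_left hmem.out hc
      rw [add_apply, add_apply, smul_apply, smul_apply, smul_eq_mul, smul_eq_mul]
      linarith
  -- If `x` is not in `π f`, it violates an inequality `A' i` of `Q`. Adding a little of an interior
  -- functional moves `A' i` into `Ω`, and adding a small multiple of the result to `l₀` lands in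
  -- `U`.
  have hQ : x ∈ (π f).1 ↔ ¬ (Ω ∩ (U ∩ W)).Nonempty := by
    constructor
    · rintro hxf ⟨l, hl, -, hlW⟩
      obtain ⟨g, hlg⟩ := exists_mem_cell (interior_subset hl)
      exact absurd ((hπ _).1 (cell_subset_normalCone _ hlg) _ (hy _) _ ((π f).subset hxf))
        (not_le.2 (hlW _))
    · intro hempty
      have hl₀x := hx l₀ (cell_subset_normalCone f h₀) _ (hy f)
      have hl₀N := (hπ f).1 (cell_subset_normalCone f h₀)
      by_contra hxf
      have hxQ : x ∉ polyhedron A' b' := fun hxQ => hxf <| by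
        have : l₀.toExposed (polyhedron A' b') = (π f).1 := hπ.mem_cell h h₀
        rw [← this]
        exact ⟨hxQ, fun z hz => (hl₀N _ (hy f) z hz).trans hl₀x.ge⟩
      simp only [polyhedron, Set.mem_ofPred_eq, not_forall, not_le] at hxQ
      obtain ⟨i, hi⟩ := hxQ
      have hiW : A' i ∈ W := fun g => ((π g).subset (hy g) i).trans_lt hi
      have his : A' i ∈ fanSupport (polyhedron A b) :=
        hsupp ▸ coeff_mem_fanSupport (nonempty_iff_nonempty_face.2 ⟨π f⟩) i
      obtain ⟨ω, hω⟩ := hΩ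
      obtain ⟨δ, hδ, hnW⟩ := exists_add_smul_mem_of_isOpen hWo hiW ω
      have hnΩ := smul_add_mem_interior_fanSupport his hω hδ
      obtain ⟨c, hc, hcU⟩ := exists_add_smul_mem_of_isOpen hU hl₀ (A' i + δ • ω)
      refine hempty ⟨_, smul_add_mem_interior_fanSupport (cell_subset_fanSupport f h₀) hnΩ hc,
        hcU, fun g => ?_⟩
      have h1 := hl₀N _ (hy f) _ ((π g).subset (hy g))
      have h2 := mul_lt_mul_of_pos_left (hnW g) hc
      rw [add_apply, add_apply, smul_apply, smul_apply, smul_eq_mul, smul_eq_mul]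
      linarith
  have hopen : ∀ D : Set (StrongDual ℝ (Fin d → ℝ)), IsOpen D → D.Nonempty →
      Module.finrank ℝ (vectorSpan ℝ D) + 0 = d := by
    intro D hD hne
    rw [← direction_affineSpan, hD.affineSpan_eq_top hne, AffineSubspace.direction_top,
      finrank_top, ← (LinearMap.toContinuousLinearMap (𝕜 := ℝ) (E := Fin d → ℝ)
        (F' := ℝ)).finrank_eq, add_zero]
    have := Subspace.dual_finrank_eq (K := ℝ) (V := Fin d → ℝ)
    rwa [Module.finrank_fin_fun] at this
  -- `Ω ∩ V` is open and convex, hence of full dimension, and the cells meeting `V` inside `Ω`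
  -- partition it.
  have hsum : ∀ V : Set (StrongDual ℝ (Fin d → ℝ)), IsOpen V → Convex ℝ V → V ⊆ U →
      (Ω ∩ V).Nonempty →
      ∑ g : Face (polyhedron A b) with (g.1 ⊆ f.1 ∧ cell g ⊆ Ω) ∧ (cell g ∩ V).Nonempty,
        (-1 : ℤ) ^ g.dim = 1 := by
    intro V hV hVc hVU hne
    have hΩo : IsOpen Ω := isOpen_interior
    have := sum_neg_one_pow_dim_of_partition
      (Finset.univ.filter fun g : Face (polyhedron A b) =>
        (g.1 ⊆ f.1 ∧ cell g ⊆ Ω) ∧ (cell g ∩ V).Nonempty) hV hVc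
      (fun g hg => (Finset.mem_filter.1 hg).2.2)
      (IsRelOpenConvex.of_isOpen (hΩo.inter hV) (convex_fanSupport.interior.inter hVc)) hne
      (hopen _ (hΩo.inter hV) hne) ?_
    · simpa using this
    · ext l
      simp only [Set.mem_iUnion, Finset.mem_filter_univ, exists_prop]
      constructor
      · rintro ⟨hl, hlV⟩
        obtain ⟨g, hlg⟩ := exists_mem_cell (interior_subset hl)
        exact ⟨_, ⟨⟨hUf l (hVU hlV) _ (cell_subset_normalCone _ hlg),
          cell_subset_interior_of_mem hlg hl⟩, l, hlg, hlV⟩, hlg, hlV⟩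
      · rintro ⟨g, ⟨⟨-, hg⟩, -⟩, hl, hlV⟩
        exact ⟨hg hl, hlV⟩
  have hΩU : (Ω ∩ U).Nonempty := by
    obtain ⟨ω, hω⟩ := hΩ
    obtain ⟨c, hc, hcU⟩ := exists_add_smul_mem_of_isOpen hU hl₀ ω
    exact ⟨_, smul_add_mem_interior_fanSupport (cell_subset_fanSupport f h₀) hω hc, hcU⟩
  have h1 : ∑ g : Face (polyhedron A b) with g.1 ⊆ f.1 ∧ cell g ⊆ Ω, (-1 : ℤ) ^ g.dim = 1 := by
    refine Eq.trans (Finset.sum_congr (Finset.filter_congr fun g _ => ?_) fun _ _ => rfl)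
      (hsum U hU hc subset_rfl hΩU)
    refine ⟨fun hg => ⟨hg, ?_⟩, fun hg => hg.1⟩
    obtain ⟨l, hl⟩ := cell_nonempty g
    obtain ⟨c, -, hmem⟩ := exists_mem_cell_inter hg.1 h₀ hU hl₀ hl
    exact ⟨_, hmem⟩
  -- By `hK` the cones that miss `x` are those whose cell meets `U ∩ W`. The left side is thus `1`
  -- minus the signed count for `U ∩ W`, which is `1` or `0` according to `hQ`.
  have h2 : ∑ g : Face (polyhedron A b) with g.1 ⊆ f.1 ∧ cell g ⊆ Ω,
      (if x ∈ shiftedCone π f g then (-1 : ℤ) ^ g.dim else 0) =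
      ∑ g : Face (polyhedron A b) with g.1 ⊆ f.1 ∧ cell g ⊆ Ω, (-1 : ℤ) ^ g.dim -
        ∑ g : Face (polyhedron A b) with
          (g.1 ⊆ f.1 ∧ cell g ⊆ Ω) ∧ (cell g ∩ (U ∩ W)).Nonempty, (-1 : ℤ) ^ g.dim := by
    simp only [Finset.sum_filter, ← Finset.sum_sub_distrib]
    refine Finset.sum_congr rfl fun g _ => ?_
    by_cases hg : g.1 ⊆ f.1 ∧ cell g ⊆ Ω
    · by_cases hne : (cell g ∩ (U ∩ W)).Nonempty
      · simp only [hK g hg.1, hg, hne, and_self, not_true_eq_false, if_true, if_false, sub_self]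
      · simp only [hK g hg.1, hg, hne, and_self, and_false, not_false_eq_true, if_true, if_false,
          sub_zero]
    · simp only [hg, false_and, if_false, sub_zero]
  rw [h2, h1]
  by_cases hne : (Ω ∩ (U ∩ W)).Nonempty
  · rw [hsum _ (hU.inter hWo) (hc.inter hWc) Set.inter_subset_left hne, if_neg (by simpa [hQ])]
    norm_num
  · rw [if_pos (hQ.2 hne), Finset.sum_eq_zero, sub_zero]
    intro g hg
    obtain ⟨⟨-, hgΩ⟩, l, hl, hlV⟩ := (Finset.mem_filter.1 hg).2
    exact absurd ⟨l, hgΩ hl, hlV⟩ hne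

end

/-! ### Series that represent rational functions -/

section Series

variable {d : ℕ} {R : Type*} [CommRing R]

theorem seriesMul_add (q : Laurent R d) (s t : (Fin d → ℤ) → R) :
    seriesMul q (s + t) = seriesMul q s + seriesMul q t := by
  funext b
  simp [seriesMul, Finsupp.sum, mul_add, Finset.sum_add_distrib]

theorem add_seriesMul (q q' : Laurent R d) (s : (Fin d → ℤ) → R) :
    seriesMul (q + q') s = seriesMul q s + seriesMul q' s := by
  classical
  funext b
  simp only [seriesMul, AddMonoidAlgebra.coeff_add, Pi.add_apply]
  exact Finsupp.sum_add_index' (by simp) (by intros; ring)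

theorem seriesMul_single (a : Fin d → ℤ) (c : R) (s : (Fin d → ℤ) → R) (b : Fin d → ℤ) :
    seriesMul (AddMonoidAlgebra.single a c) s b = c * s (b - a) := by
  simp [seriesMul]

theorem mul_seriesMul (q q' : Laurent R d) (s : (Fin d → ℤ) → R) :
    seriesMul (q * q') s = seriesMul q (seriesMul q' s) := by
  induction q using AddMonoidAlgebra.induction_linear with
  | zero => funext b; simp [seriesMul]
  | add f g hf hg => rw [add_mul, add_seriesMul, hf, hg, add_seriesMul]
  | single a c =>
    induction q' using AddMonoidAlgebra.induction_linear with
    | zero => funext b; simp [seriesMul]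
    | add f g hf hg => rw [mul_add, add_seriesMul, hf, hg, add_seriesMul, seriesMul_add]
    | single a' c' =>
      funext b
      rw [AddMonoidAlgebra.single_mul_single, seriesMul_single, seriesMul_single, seriesMul_single,
        mul_assoc, sub_add_eq_sub_sub]

theorem one_seriesMul (s : (Fin d → ℤ) → R) : seriesMul 1 s = s := by
  funext b
  rw [AddMonoidAlgebra.one_def, seriesMul_single, sub_zero, one_mul]

theorem seriesMul_one_sub_single (u : Fin d → ℤ) (s : (Fin d → ℤ) → R) (b : Fin d → ℤ) :
    seriesMul (1 - AddMonoidAlgebra.single u 1) s b = s b - s (b - u) := by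
  have h : seriesMul ((1 - AddMonoidAlgebra.single u 1) + AddMonoidAlgebra.single u 1) s = s := by
    rw [sub_add_cancel, one_seriesMul]
  have := congrFun h b
  rw [add_seriesMul, Pi.add_apply, seriesMul_single, one_mul] at this
  exact eq_sub_of_add_eq this

/-- A Laurent polynomial killed by `1 - e^u` has `u`-periodic coefficients, which is incompatible
with finite support unless it is zero. This holds over every commutative ring. -/
theorem one_sub_single_mem_nonZeroDivisors {u : Fin d → ℤ} (hu : u ≠ 0) :
    (1 - AddMonoidAlgebra.single u 1 : Laurent R d) ∈ nonZeroDivisors (Laurent R d) := by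
  rw [mem_nonZeroDivisors_iff_right]
  intro p hp
  rw [mul_comm] at hp
  have hper : ∀ b, p.coeff b = p.coeff (b - u) := fun b => by
    have := congrFun (seriesMul_coeff (1 - AddMonoidAlgebra.single u 1) p) b
    rw [hp, seriesMul_one_sub_single] at this
    exact sub_eq_zero.1 (by simpa using this)
  by_contra hp0
  have hne : p.coeff ≠ 0 := fun h => hp0 (AddMonoidAlgebra.coeff_injective (by simpa using h))
  obtain ⟨b, hb⟩ := Finsupp.ne_iff.1 hne
  have hall : ∀ n : ℕ, p.coeff (b - n • u) ≠ 0 := by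
    intro n
    induction n with
    | zero => simpa using hb
    | succ n ih =>
      rw [hper, sub_sub, ← succ_nsmul] at ih
      exact ih
  have hinj : Function.Injective fun n : ℕ => b - n • u := by
    intro m n h
    have h' : m • u = n • u := by simpa using h
    obtain ⟨j, hj⟩ := Function.ne_iff.1 hu
    have := congrFun h' j
    simp only [Pi.smul_apply, nsmul_eq_mul] at this
    exact_mod_cast mul_right_cancel₀ hj this
  refine Set.infinite_range_of_injective hinj (p.coeff.support.finite_toSet.subset ?_)
  rintro _ ⟨n, rfl⟩
  simpa using hall n

/-- The series becomes a Laurent polynomial after multiplication by a suitable Laurent polynomial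
that is not a zero divisor. -/
def IsRatSeries (s : (Fin d → ℤ) → R) : Prop :=
  ∃ q ∈ nonZeroDivisors (Laurent R d), ∃ p : Laurent R d, ∀ b, seriesMul q s b = p.coeff b

theorem IsRatSeries.exists_hasSumRat {s : (Fin d → ℤ) → R} (h : IsRatSeries s) :
    ∃ r, HasSumRat s r := by
  obtain ⟨q, hq, p, hp⟩ := h
  refine ⟨IsLocalization.mk' (RatFun R d) p (⟨q, hq⟩ : nonZeroDivisors (Laurent R d)),
    q, hq, p, hp, ?_⟩
  exact IsLocalization.mk'_spec (RatFun R d) p (⟨q, hq⟩ : nonZeroDivisors (Laurent R d))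

theorem IsRatSeries.of_seriesMul {q : Laurent R d} (hq : q ∈ nonZeroDivisors (Laurent R d))
    {s : (Fin d → ℤ) → R} (h : IsRatSeries (seriesMul q s)) : IsRatSeries s := by
  obtain ⟨q', hq', p, hp⟩ := h
  refine ⟨q' * q, mul_mem hq' hq, p, ?_⟩
  rwa [mul_seriesMul]

theorem seriesMul_mul_add {q q' p p' : Laurent R d} {s t : (Fin d → ℤ) → R}
    (hp : ∀ b, seriesMul q s b = p.coeff b) (hp' : ∀ b, seriesMul q' t b = p'.coeff b)
    (b : Fin d → ℤ) : seriesMul (q * q') (s + t) b = (q' * p + q * p').coeff b := by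
  have h : seriesMul (q * q') s = (q' * p).coeff := by
    rw [mul_comm, mul_seriesMul, funext hp, seriesMul_coeff]
  have h' : seriesMul (q * q') t = (q * p').coeff := by
    rw [mul_seriesMul, funext hp', seriesMul_coeff]
  rw [seriesMul_add, h, h']
  simp

theorem IsRatSeries.add {s t : (Fin d → ℤ) → R} (hs : IsRatSeries s) (ht : IsRatSeries t) :
    IsRatSeries (s + t) := by
  obtain ⟨q, hq, p, hp⟩ := hs
  obtain ⟨q', hq', p', hp'⟩ := ht
  refine ⟨q * q', mul_mem hq hq', q' * p + q * p', fun b => ?_⟩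
  exact seriesMul_mul_add hp hp' b

theorem isRatSeries_zero : IsRatSeries (0 : (Fin d → ℤ) → R) :=
  ⟨1, one_mem _, 0, fun b => by simp [one_seriesMul]⟩

theorem isRatSeries_of_subsingleton {s : (Fin d → ℤ) → R}
    (h : ∀ x y, s x ≠ 0 → s y ≠ 0 → x = y) : IsRatSeries s := by
  by_cases h0 : ∃ x, s x ≠ 0
  · obtain ⟨x, hx⟩ := h0
    refine ⟨1, one_mem _, AddMonoidAlgebra.single x (s x), fun b => ?_⟩
    rw [one_seriesMul]
    by_cases hb : x = b
    · subst hb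
      simp
    · rw [AddMonoidAlgebra.coeff_single, Finsupp.single_eq_of_ne (Ne.symm hb)]
      by_contra hsb
      exact hb (h x b hx hsb)
  · push Not at h0
    rw [show s = 0 from funext h0]
    exact isRatSeries_zero

theorem HasSumRat.sumRat_eq {s : (Fin d → ℤ) → R} {r : RatFun R d} (h : HasSumRat s r) :
    sumRat s = r := by
  have hex : ∃ r, HasSumRat s r := ⟨r, h⟩
  rw [sumRat, dif_pos hex]
  exact hex.choose_spec.unique h

theorem HasSumRat.add {s t : (Fin d → ℤ) → R} {r r' : RatFun R d} (hs : HasSumRat s r)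
    (ht : HasSumRat t r') : HasSumRat (s + t) (r + r') := by
  obtain ⟨q, hq, p, hp, h⟩ := hs
  obtain ⟨q', hq', p', hp', h'⟩ := ht
  refine ⟨q * q', mul_mem hq hq', q' * p + q * p', fun b => ?_, ?_⟩
  · exact seriesMul_mul_add hp hp' b
  · rw [map_mul, map_add, map_mul, map_mul, ← h, ← h']
    ring

theorem hasSumRat_zero : HasSumRat (0 : (Fin d → ℤ) → R) 0 :=
  ⟨1, one_mem _, 0, fun b => by simp [one_seriesMul], by simp⟩

theorem HasSumRat.sum {ι : Type*} (I : Finset ι) {s : ι → (Fin d → ℤ) → R} {r : ι → RatFun R d}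
    (h : ∀ i ∈ I, HasSumRat (s i) (r i)) : HasSumRat (∑ i ∈ I, s i) (∑ i ∈ I, r i) := by
  classical
  induction I using Finset.induction_on with
  | empty => simpa using hasSumRat_zero
  | insert a I ha ih =>
    rw [Finset.sum_insert ha, Finset.sum_insert ha]
    exact (h a (Finset.mem_insert_self a I)).add
      (ih fun i hi => h i (Finset.mem_insert_of_mem hi))

theorem HasSumRat.shift {s : (Fin d → ℤ) → R} {r : RatFun R d} (h : HasSumRat s r)
    (w : Fin d → ℤ) : HasSumRat (fun a => s (a - w)) (expMonomial R w * r) := by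
  obtain ⟨q, hq, p, hp, hr⟩ := h
  have hs : (fun a => s (a - w)) = seriesMul (AddMonoidAlgebra.single w 1) s := by
    funext a
    rw [seriesMul_single, one_mul]
  refine ⟨q, hq, AddMonoidAlgebra.single w 1 * p, fun b => ?_, ?_⟩
  · rw [hs, seriesMul_comm, funext hp, seriesMul_coeff]
  · rw [map_mul, ← hr, expMonomial]
    ring

theorem hasSumRat_zero_of_periodic {u : Fin d → ℤ} (hu : u ≠ 0) {s : (Fin d → ℤ) → R}
    (h : ∀ a, s (a + u) = s a) : HasSumRat s 0 := by
  refine ⟨1 - AddMonoidAlgebra.single u 1, one_sub_single_mem_nonZeroDivisors hu, 0, fun b => ?_,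
    by simp⟩
  rw [seriesMul_one_sub_single, ← h (b - u), sub_add_cancel, sub_self]
  simp

/-! ### Functions of truncated linear forms -/

/-- `x` and `y` cannot be distinguished by the values of the forms `A i`, truncated at `±N`. -/
def ClipEquiv {ι : Type*} (A : ι → (Fin d → ℤ) →+ ℤ) (N : ℤ) (x y : Fin d → ℤ) : Prop :=
  ∀ i, A i x = A i y ∨ (N < A i x ∧ N < A i y) ∨ (A i x < -N ∧ A i y < -N)

theorem ClipEquiv.mono {ι : Type*} {A : ι → (Fin d → ℤ) →+ ℤ} {N M : ℤ} {x y : Fin d → ℤ}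
    (h : ClipEquiv A N x y) (hM : M ≤ N) : ClipEquiv A M x y := fun i => by
  have := h i
  omega

theorem ClipEquiv.sub {ι : Type*} {A : ι → (Fin d → ℤ) →+ ℤ} {N M : ℤ} {x y u : Fin d → ℤ}
    (h : ClipEquiv A (N + M) x y) (hM : ∀ i, |A i u| ≤ M) : ClipEquiv A N (x - u) (y - u) :=
  fun i => by
  have h1 := h i
  have h2 := abs_le.1 (hM i)
  rw [map_sub, map_sub]
  omega

theorem clipEquiv_sub_self {ι : Type*} {A : ι → (Fin d → ℤ) →+ ℤ} {N M : ℤ} {x u : Fin d → ℤ}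
    (hM : ∀ i, |A i u| ≤ M) (h : ∀ i, A i u = 0 ∨ N + M < |A i x|) : ClipEquiv A N x (x - u) :=
  fun i => by
  have h1 := abs_le.1 (hM i)
  rw [map_sub]
  rcases h i with h | h
  · left
    omega
  · rcases lt_abs.1 h with h | h <;> omega

/-- The slices are split off one at a time. Lying on `A t.1 x = t.2` is visible to the truncated
forms once the threshold is at least `|t.2|`. -/
theorem isRatSeries_of_slices {ι : Type*} {A : ι → (Fin d → ℤ) →+ ℤ} {Z : Set (Fin d → ℤ)}
    (T : Finset (ι × ℤ))
    (ih : ∀ t ∈ T, ∀ (G : (Fin d → ℤ) → R) (N : ℤ), (∀ x y, ClipEquiv A N x y → G x = G y) →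
      (∀ x, G x ≠ 0 → x ∈ Z ∧ A t.1 x = t.2) → IsRatSeries G)
    (G : (Fin d → ℤ) → R) (N : ℤ) (hG : ∀ x y, ClipEquiv A N x y → G x = G y)
    (hsupp : ∀ x, G x ≠ 0 → x ∈ Z ∧ ∃ t ∈ T, A t.1 x = t.2) : IsRatSeries G := by
  classical
  induction T using Finset.induction_on generalizing G N with
  | empty =>
    refine isRatSeries_of_subsingleton fun x _ hx _ => ?_
    obtain ⟨-, t, ht, -⟩ := hsupp x hx
    simp at ht
  | insert t T ht ihT =>
    have hclip : ∀ x y, ClipEquiv A (max N |t.2|) x y → (A t.1 x = t.2 ↔ A t.1 y = t.2) := by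
      intro x y h
      have h1 := h t.1
      have h2 := le_max_right N |t.2|
      have h3 := abs_le.1 h2
      omega
    have hdec : G = (fun x => if A t.1 x = t.2 then G x else 0) +
        fun x => if A t.1 x = t.2 then 0 else G x := by
      funext x
      simp only [Pi.add_apply]
      split_ifs <;> simp
    rw [hdec]
    refine IsRatSeries.add ?_ ?_
    · refine ih t (Finset.mem_insert_self t T) _ (max N |t.2|) (fun x y h => ?_) fun x hx => ?_
      · simp only [hclip x y h, hG x y (h.mono (le_max_left _ _))]
      · split_ifs at hx with hxt
        · exact ⟨(hsupp x hx).1, hxt⟩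
        · exact absurd rfl hx
    · refine ihT (fun t' ht' => ih t' (Finset.mem_insert_of_mem ht')) _ (max N |t.2|)
        (fun x y h => ?_) fun x hx => ?_
      · simp only [hclip x y h, hG x y (h.mono (le_max_left _ _))]
      · split_ifs at hx with hxt
        · exact absurd rfl hx
        · obtain ⟨hxZ, t', ht', h'⟩ := hsupp x hx
          rcases Finset.mem_insert.1 ht' with rfl | ht'
          · exact absurd h' hxt
          · exact ⟨hxZ, t', ht', h'⟩

/-- A function of finitely many truncated integral linear forms represents a rational function. -/
theorem isRatSeries_of_clipEquiv {ι : Type*} [Fintype ι] (A : ι → (Fin d → ℤ) →+ ℤ)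
    (F : (Fin d → ℤ) → R) (N : ℤ) (hF : ∀ x y, ClipEquiv A N x y → F x = F y) :
    IsRatSeries F := by
  classical
  -- The induction is on the number of forms not yet fixed on the support of `F`; `I` collects the
  -- fixed ones.
  suffices H : ∀ (n : ℕ) (I : Finset ι) (c : ι → ℤ) (F : (Fin d → ℤ) → R) (N : ℤ), Iᶜ.card = n →
      (∀ x y, ClipEquiv A N x y → F x = F y) → (∀ x, F x ≠ 0 → ∀ i ∈ I, A i x = c i) →
      IsRatSeries F from
    H _ ∅ 0 F N rfl hF (by simp)
  clear hF N F
  intro n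
  induction n using Nat.strong_induction_on with
  | _ n ih =>
    intro I c F N hn hF hsupp
    -- If the forms in `I` have no common integer zero `u ≠ 0`, the support has at most one point.
    -- Otherwise `F x - F (x - u)` vanishes unless some form outside `I` is bounded by `N + M` at
    -- `x`. This leaves finitely many slices, on each of which one more form is fixed.
    by_cases hL : ∃ u : Fin d → ℤ, u ≠ 0 ∧ ∀ i ∈ I, A i u = 0
    swap
    · push Not at hL
      refine isRatSeries_of_subsingleton fun x y hx hy => ?_
      by_contra hxy
      obtain ⟨i, hi, hne⟩ := hL (x - y) (sub_ne_zero.2 hxy)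
      rw [map_sub, hsupp x hx i hi, hsupp y hy i hi, sub_self] at hne
      exact hne rfl
    obtain ⟨u, hu, huI⟩ := hL
    refine IsRatSeries.of_seriesMul (one_sub_single_mem_nonZeroDivisors hu) ?_
    set M := ∑ i, |A i u| with hMdef
    have hM : ∀ i, |A i u| ≤ M := fun i =>
      Finset.single_le_sum (f := fun i => |A i u|) (fun j _ => abs_nonneg _) (Finset.mem_univ i)
    have hM0 : 0 ≤ M := Finset.sum_nonneg fun i _ => abs_nonneg _
    refine isRatSeries_of_slices (A := A) (Z := {x | ∀ i ∈ I, A i x = c i})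
      (Iᶜ ×ˢ Finset.Icc (-(N + M)) (N + M)) (fun t ht G K hG hGsupp => ?_) _ (N + M)
      (fun x y h => ?_) fun x hx => ?_
    · have htI : t.1 ∉ I := by simpa using (Finset.mem_product.1 ht).1
      refine ih ((insert t.1 I)ᶜ.card) ?_ (insert t.1 I) (Function.update c t.1 t.2) G K rfl hG ?_
      · rw [← hn]
        refine Finset.card_lt_card (Finset.compl_ssubset_compl.2 (Finset.ssubset_insert htI))
      · intro x hx i hi
        obtain ⟨hxZ, hxt⟩ := hGsupp x hx
        rcases Finset.mem_insert.1 hi with rfl | hi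
        · rw [Function.update_self, hxt]
        · rw [Function.update_of_ne (ne_of_mem_of_not_mem hi htI)]
          exact hxZ i hi
    · rw [seriesMul_one_sub_single, seriesMul_one_sub_single, hF x y (h.mono (by omega)),
        hF _ _ (h.sub hM)]
    · rw [seriesMul_one_sub_single] at hx
      refine ⟨fun i hi => ?_, ?_⟩
      · by_cases hx0 : F x = 0
        · have : F (x - u) ≠ 0 := fun h => hx (by rw [hx0, h, sub_zero])
          have := hsupp _ this i hi
          rwa [map_sub, huI i hi, sub_zero] at this
        · exact hsupp x hx0 i hi
      · by_contra hcon
        push Not at hcon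
        refine hx (sub_eq_zero.2 (hF _ _ (clipEquiv_sub_self hM fun i => ?_)))
        by_cases hi : i ∈ I
        · exact Or.inl (huI i hi)
        · right
          by_contra! hle
          exact hcon (i, A i x) (by simpa [hi] using abs_le.1 hle) rfl

end Series

/-! ### Weighted series of rational polyhedra -/

section WeightedSeries

variable {d : ℕ} {R : Type*} [CommRing R] {P : Set (Fin d → ℝ)}

/-- An integer vector as a real vector. -/
def realVec (a : Fin d → ℤ) : Fin d → ℝ := fun i => (a i : ℝ)

theorem weightedSeries_eq_of_isMinFace {φ : Face P → R} {a : Fin d → ℤ} {f : Face P}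
    (h : IsMinFace (realVec a) f) : weightedSeries P φ a = φ f := by
  have hex : ∃ f : Face P, IsMinFace (fun i => (a i : ℝ)) f := ⟨f, h⟩
  rw [weightedSeries, dif_pos hex]
  exact congrArg φ (hex.choose_spec.unique h)

theorem weightedSeries_eq_zero {φ : Face P → R} {a : Fin d → ℤ} (h : realVec a ∉ P) :
    weightedSeries P φ a = 0 :=
  dif_neg fun ⟨f, hf⟩ => h (f.subset hf.1)

theorem weightedSeries_congr {φ : Face P → R} {a a' : Fin d → ℤ}
    (h : ∀ f : Face P, realVec a ∈ f.1 ↔ realVec a' ∈ f.1) :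
    weightedSeries P φ a = weightedSeries P φ a' := by
  classical
  have : (fun f : Face P => IsMinFace (fun i => (a i : ℝ)) f) =
      fun f => IsMinFace (fun i => (a' i : ℝ)) f := by
    funext f
    exact propext (and_congr (h f) (forall_congr' fun g => imp_congr (h g) Iff.rfl))
  exact congrArg (fun p : Face P → Prop => if h : ∃ f, p f then φ h.choose else 0) this

variable {ι : Type*} [Fintype ι]

/-- The functional with given integer coefficients. -/
def intForm (a : Fin d → ℤ) : StrongDual ℝ (Fin d → ℝ) := coeffForm (realVec a)

theorem intForm_realVec (a x : Fin d → ℤ) : intForm a (realVec x) = ((∑ j, a j * x j : ℤ) : ℝ) := by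
  simp [intForm, coeffForm_apply, realVec]

theorem IsRationalPolyhedron.exists_eq_polyhedron (hP : IsRationalPolyhedron P) :
    ∃ (m : ℕ) (A : Fin m → Fin d → ℤ) (b : Fin m → ℤ),
      P = polyhedron (fun i => intForm (A i)) fun i => (b i : ℝ) := by
  obtain ⟨m, A, b, rfl⟩ := hP
  exact ⟨m, A, b, by simp [polyhedron, intForm, coeffForm_apply, realVec]⟩

/-- Which faces contain a point depends only on the comparison of each form with `b i`, and this
survives truncation at any common bound of the `|b i|`, such as their sum. -/
theorem isRatSeries_weightedSeries {A : ι → Fin d → ℤ} {b : ι → ℤ}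
    (φ : Face (polyhedron (fun i => intForm (A i)) fun i => (b i : ℝ)) → R) :
    IsRatSeries (weightedSeries _ φ) := by
  let B : ι → (Fin d → ℤ) →+ ℤ := fun i => AddMonoidHom.mk' (fun x => ∑ j, A i j * x j)
    fun x y => by simp [mul_add, Finset.sum_add_distrib]
  have hB : ∀ i x, intForm (A i) (realVec x) = (B i x : ℝ) := fun i x => intForm_realVec _ _
  refine isRatSeries_of_clipEquiv B _ (∑ i, |b i|) fun x y h => weightedSeries_congr ?_
  have hb : ∀ i, |b i| ≤ ∑ i, |b i| := fun i =>
    Finset.single_le_sum (f := fun i => |b i|) (fun j _ => abs_nonneg _) (Finset.mem_univ i)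
  have key : ∀ x y, ClipEquiv B (∑ i, |b i|) x y →
      ∀ f : Face (polyhedron (fun i => intForm (A i)) fun i => (b i : ℝ)),
      realVec x ∈ f.1 → realVec y ∈ f.1 := by
    intro x y h f hx
    refine mem_of_tight_subset hx (fun i => ?_) fun i hi => ?_
    · have h0 := f.subset hx i
      rw [hB, Int.cast_le] at h0 ⊢
      have h1 := h i
      have h2 := abs_le.1 (hb i)
      omega
    · rw [hB, Int.cast_inj] at hi ⊢
      have h1 := h i
      have h2 := abs_le.1 (hb i)
      omega
  refine fun f => ⟨key x y h f, key y x (fun i => ?_) f⟩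
  have := h i
  omega

end WeightedSeries

/-! ### Vertices, tangent cones and lattice directions -/

/-- The Gram matrix `Mᵀ M` is singular over the reals, so its integer determinant is zero and it
kills an integer vector `u ≠ 0`. Then `M u` has square norm zero. -/
theorem exists_int_ne_zero_of_real {ι : Type*} [Fintype ι] {d : ℕ} (B : ι → Fin d → ℤ)
    {z : Fin d → ℝ} (hz : z ≠ 0) (h : ∀ i, intForm (B i) z = 0) :
    ∃ u : Fin d → ℤ, u ≠ 0 ∧ ∀ i, intForm (B i) (realVec u) = 0 := by
  let M : Matrix ι (Fin d) ℤ := Matrix.of B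
  let f : ℤ →+* ℝ := Int.castRingHom ℝ
  have hMz : (M.map f).mulVec z = 0 := by
    funext i
    have := h i
    simpa [intForm, coeffForm_apply, realVec, Matrix.mulVec, dotProduct, M, f] using this
  have hdet : (M.transpose * M).det = 0 := by
    have h1 : ((M.transpose * M).map f).det = 0 := by
      refine Matrix.exists_mulVec_eq_zero_iff.1 ⟨z, hz, ?_⟩
      rw [Matrix.map_mul, ← Matrix.mulVec_mulVec, hMz, Matrix.mulVec_zero]
    have h2 := RingHom.map_det f (M.transpose * M)
    rw [RingHom.mapMatrix_apply, h1] at h2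
    exact Int.cast_eq_zero.1 h2
  obtain ⟨u, hu, hMu⟩ := Matrix.exists_mulVec_eq_zero_iff.2 hdet
  refine ⟨u, hu, fun i => ?_⟩
  have hMu' : M.mulVec u = 0 := by
    rw [← dotProduct_self_eq_zero, Matrix.dotProduct_mulVec, ← Matrix.mulVec_transpose,
      Matrix.mulVec_mulVec, hMu, zero_dotProduct]
  have := congrFun hMu' i
  rw [intForm_realVec]
  exact_mod_cast this

section

variable {d : ℕ} {P : Set (Fin d → ℝ)}

theorem normalCone_apply_vectorSpan {f : Face P} {l : StrongDual ℝ (Fin d → ℝ)}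
    (hl : l ∈ normalCone f) {z : Fin d → ℝ} (hz : z ∈ vectorSpan ℝ f.1) : l z = 0 := by
  have h : vectorSpan ℝ f.1 ≤ LinearMap.ker (l : (Fin d → ℝ) →ₗ[ℝ] ℝ) := by
    rw [vectorSpan_def, Submodule.span_le]
    rintro _ ⟨x, hx, y, hy, rfl⟩
    simp [normalCone_apply_eq hl hx hy]
  exact h hz

theorem Vertex.face_injective : Function.Injective (Vertex.face (P := P)) := fun v w h => by
  have : ({v.1} : Set (Fin d → ℝ)) = {w.1} := congrArg Subtype.val h
  exact Subtype.ext (Set.singleton_injective this)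

theorem Face.exists_vertex_of_dim_eq_zero {f : Face P} (h : f.dim = 0) :
    ∃ v : Vertex P, v.face = f := by
  obtain ⟨x, hx⟩ := f.2.1
  have hs : f.1 = {x} := by
    refine Set.eq_singleton_iff_unique_mem.2 ⟨hx, fun y hy => ?_⟩
    have := vsub_mem_vectorSpan ℝ hy hx
    rw [Submodule.finrank_eq_zero.1 h, Submodule.mem_bot] at this
    exact vsub_eq_zero_iff_eq.1 this
  exact ⟨⟨x, hs ▸ f.2.2⟩, Subtype.ext hs.symm⟩

theorem Face.exists_int_mem_vectorSpan {ι : Type*} [Fintype ι] {A : ι → Fin d → ℤ} {b : ι → ℝ}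
    (f : Face (polyhedron (fun i => intForm (A i)) b)) (hf : f.dim ≠ 0) :
    ∃ u : Fin d → ℤ, u ≠ 0 ∧ realVec u ∈ vectorSpan ℝ f.1 := by
  classical
  obtain ⟨z, hz, hz0⟩ : ∃ z ∈ vectorSpan ℝ f.1, z ≠ 0 := by
    by_contra! hcon
    refine hf ?_
    rw [Face.dim, (Submodule.eq_bot_iff _).2 hcon, finrank_bot]
  rw [f.vectorSpan_eq] at hz ⊢
  simp only [Submodule.mem_iInf, LinearMap.mem_ker, ContinuousLinearMap.coe_coe] at hz ⊢
  obtain ⟨u, hu, h⟩ := exists_int_ne_zero_of_real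
    (fun i : {i | ∀ y ∈ f.1, intForm (A i) y = b i} => A i) hz0 fun i => hz i i.2
  exact ⟨u, hu, fun i hi => h ⟨i, hi⟩⟩

section

variable {ι : Type*} [Fintype ι] {A : ι → StrongDual ℝ (Fin d → ℝ)} {b : ι → ℝ}

theorem exists_isMinFace_of_eq (hP : P = polyhedron A b) {x : Fin d → ℝ} (hx : x ∈ P) :
    ∃ f : Face P, IsMinFace x f := by
  subst hP
  obtain ⟨f, hf, -⟩ := exists_isMinFace hx
  exact ⟨f, hf⟩

theorem tangentCone_polyhedron {v : Fin d → ℝ} (hv : v ∈ polyhedron A b) :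
    tangentCone (polyhedron A b) v =
      polyhedron (fun i : {i // A i v = b i} => A i) fun i => b i := by
  ext x
  constructor
  · rintro ⟨t, ht, y, hy, rfl⟩ ⟨i, hi⟩
    have h1 := mul_le_mul_of_nonneg_left (hy i) ht
    simp only [map_add, map_smul, map_sub, smul_eq_mul, hi]
    linarith
  · intro hx
    obtain ⟨ε, hε, hmem⟩ := exists_add_smul_mem_polyhedron (z := x - v) hv fun i hi => by
      rw [map_sub, hi, sub_nonpos]
      exact hx ⟨i, hi⟩
    refine ⟨ε⁻¹, by positivity, _, hmem, ?_⟩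
    rw [add_sub_cancel_left, smul_smul, inv_mul_cancel₀ hε.ne', one_smul, add_sub_cancel]

theorem Vertex.mem_tangentCone_iff (v : Vertex (polyhedron A b)) {x : Fin d → ℝ} :
    x ∈ tangentCone (polyhedron A b) v.1 ↔ ∀ l ∈ normalCone v.face, l x ≤ l v.1 := by
  constructor
  · rintro ⟨t, ht, y, hy, rfl⟩ l hl
    have h1 := mul_le_mul_of_nonneg_left (hl v.1 rfl y hy) ht
    simp only [map_add, map_smul, map_sub, smul_eq_mul]
    linarith
  · intro h
    rw [tangentCone_polyhedron v.mem]
    rintro ⟨i, hi⟩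
    refine (h (A i) ?_).trans hi.le
    rintro _ rfl y hy
    exact (hy i).trans hi.ge

/-- This turns the restricted weight at `x` into the conditions defining `shiftedCone`. A functional
of the cone of `f` is constant along `v + ε • (x - v)`, a point of `P` for small `ε`; conversely, a
functional exposing `f` exposes a face of the tangent cone through `x`. -/
theorem coneFace_subset_iff (v : Vertex (polyhedron A b)) {x : Fin d → ℝ}
    {g : Face (tangentCone (polyhedron A b) v.1)} (hg : IsMinFace x g)
    (f : Face (polyhedron A b)) :
    (coneFace v.mem g).1 ⊆ f.1 ↔ v.1 ∈ f.1 ∧ ∀ l ∈ normalCone f, l x = l v.1 := by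
  constructor
  · intro h
    refine ⟨h ⟨apex_mem_face v.mem g, v.mem⟩, fun l hl => ?_⟩
    have hxC : x ∈ tangentCone (polyhedron A b) v.1 := g.subset hg.1
    rw [tangentCone_polyhedron v.mem] at hxC
    obtain ⟨ε, hε, hmem⟩ := exists_add_smul_mem_polyhedron (z := x - v.1) v.mem fun i hi => by
      rw [map_sub, hi, sub_nonpos]
      exact hxC ⟨i, hi⟩
    have hmemg : v.1 + ε • (x - v.1) ∈ g.1 := by
      obtain ⟨m, hm⟩ := g.exists_toExposed_eq
      have hv := apex_mem_face v.mem g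
      have hx := hg.1
      rw [← hm] at hx hv ⊢
      have h1 : m x = m v.1 := le_antisymm (hv.2 x hx.1) (hx.2 _ hv.1)
      refine ⟨subset_tangentCone _ _ hmem, fun y hy => (hv.2 y hy).trans (le_of_eq ?_)⟩
      rw [map_add, map_smul, map_sub, h1, sub_self, smul_zero, add_zero]
    have hf := h ⟨hmemg, hmem⟩
    have hvf := h ⟨apex_mem_face v.mem g, v.mem⟩
    have := normalCone_apply_eq hl hf hvf
    rw [map_add, map_smul, smul_eq_mul, add_eq_left, mul_eq_zero, map_sub, sub_eq_zero] at this
    exact this.resolve_left hε.ne'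
  · rintro ⟨hvf, hx⟩
    obtain ⟨l, hl⟩ := cell_nonempty f
    have hlf : l.toExposed (polyhedron A b) = f.1 := hl
    have hlv : l ∈ normalCone v.face :=
      normalCone_antitone (Set.singleton_subset_iff.2 hvf) (cell_subset_normalCone f hl)
    have hmax : ∀ y ∈ tangentCone (polyhedron A b) v.1, l y ≤ l v.1 := fun y hy =>
      v.mem_tangentCone_iff.1 hy l hlv
    have hxe : x ∈ l.toExposed (tangentCone (polyhedron A b) v.1) :=
      ⟨g.subset hg.1, fun y hy => (hmax y hy).trans (hx l (cell_subset_normalCone f hl)).ge⟩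
    have hsub := hg.2 (faceOf ⟨x, hxe⟩) hxe
    rintro y ⟨hyg, hyP⟩
    have hy : y ∈ l.toExposed (tangentCone (polyhedron A b) v.1) := hsub hyg
    rw [← hlf]
    exact ⟨hyP, fun z hz => hy.2 z (subset_tangentCone _ _ hz)⟩

open Classical in
/-- A nonempty polyhedron that contains no line has a vertex. -/
theorem exists_vertex (hne : (polyhedron A b).Nonempty) (hA : ∀ z, (∀ i, A i z = 0) → z = 0) :
    Nonempty (Vertex (polyhedron A b)) := by
  have hex : ∃ n, ∃ x ∈ polyhedron A b, (Finset.univ.filter fun i => A i x ≠ b i).card = n := by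
    obtain ⟨x, hx⟩ := hne
    exact ⟨_, x, hx, rfl⟩
  obtain ⟨x, hx, hn⟩ := Nat.find_spec hex
  -- `x` has the fewest non-tight inequalities. Moving along a direction `z` that keeps the tight
  -- ones, up to the first newly tight inequality (the minimal ratio), would lower that number.
  have key : ∀ z, (∀ i, A i x = b i → A i z = 0) → ∀ j, ¬ 0 < A j z := by
    intro z hz j hj
    obtain ⟨k, hk, hmin⟩ := Finset.exists_min_image (Finset.univ.filter fun j => 0 < A j z)
      (fun j => (b j - A j x) / A j z) ⟨j, by simpa using hj⟩
    have hk : 0 < A k z := by simpa using hk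
    set t := (b k - A k x) / A k z with ht
    have ht0 : 0 ≤ t := div_nonneg (sub_nonneg.2 (hx k)) hk.le
    have hmem : x + t • z ∈ polyhedron A b := by
      intro i
      rw [map_add, map_smul, smul_eq_mul]
      rcases le_or_gt (A i z) 0 with hi | hi
      · have := mul_nonpos_of_nonneg_of_nonpos ht0 hi
        have := hx i
        linarith
      · have := hmin i (by simpa using hi)
        rw [le_div_iff₀ hi] at this
        linarith
    refine Nat.find_min hex ?_ ⟨_, hmem, rfl⟩
    rw [← hn]
    refine Finset.card_lt_card (Finset.ssubset_iff_subset_ne.2 ⟨fun i hi => ?_, fun h => ?_⟩)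
    · simp only [Finset.mem_filter_univ] at hi ⊢
      intro hix
      rw [map_add, map_smul, hz i hix, smul_zero, add_zero] at hi
      exact hi hix
    · have : k ∈ Finset.univ.filter fun i => A i x ≠ b i := by
        simp only [Finset.mem_filter_univ]
        exact fun hkx => hk.ne' (hz k hkx)
      rw [← h, Finset.mem_filter_univ, map_add, map_smul, smul_eq_mul, ht,
        div_mul_cancel₀ _ hk.ne', add_sub_cancel] at this
      exact this rfl
  obtain ⟨f, hf, hfeq⟩ := exists_isMinFace hx
  have hs : f.1 = {x} := by
    refine Set.eq_singleton_iff_unique_mem.2 ⟨hf.1, fun y hy => ?_⟩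
    rw [hfeq] at hy
    rw [← sub_eq_zero]
    have hz : ∀ i, A i x = b i → A i (y - x) = 0 := fun i hi => by
      rw [map_sub, hy.2 i hi, hi, sub_self]
    refine hA _ fun i => le_antisymm (not_lt.1 (key _ hz i)) ?_
    have := not_lt.1 (key (-(y - x)) (fun i hi => by rw [map_neg, hz i hi, neg_zero]) i)
    rw [map_neg] at this
    linarith
  exact ⟨⟨x, hs ▸ f.2.2⟩⟩

end

end

open Classical in
-- Möbius inversion, with `μ` defined recursively from the large sets to the small ones.
theorem exists_sum_superset {α R : Type*} [AddCommGroup R] {X : Type*}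
    (e : α → Set X) (he : Function.Injective e) [Fintype α] (φ : α → R) :
    ∃ μ : α → R, ∀ g, φ g = ∑ f with e g ⊆ e f, μ f := by
  have : IsTrans α fun f g => e g ⊂ e f := ⟨fun _ _ _ h h' => h'.trans h⟩
  have : Std.Irrefl fun f g : α => e g ⊂ e f := ⟨fun _ h => ssubset_irrefl _ h⟩
  have wf : WellFounded fun f g : α => e g ⊂ e f := Finite.wellFounded_of_trans_of_irrefl _
  let μ : α → R := wf.fix fun g rec => φ g - ∑ f : {f // e g ⊂ e f}, rec f.1 f.2
  have hμ : ∀ g, μ g = φ g - ∑ f : {f // e g ⊂ e f}, μ f.1 := fun g => wf.fix_eq _ g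
  refine ⟨μ, fun g => ?_⟩
  have hfil : (Finset.univ.filter fun f => e g ⊆ e f) =
      insert g (Finset.univ.filter fun f => e g ⊂ e f) := by
    ext f
    simp only [Finset.mem_filter_univ, Finset.mem_insert, subset_iff_ssubset_or_eq]
    constructor
    · rintro (h | h)
      · exact Or.inr h
      · exact Or.inl (he h).symm
    · rintro (rfl | h)
      · exact Or.inr rfl
      · exact Or.inl h
  rw [hfil, Finset.sum_insert (by simp), hμ g,
    Finset.sum_subtype (p := fun f => e g ⊂ e f) _ (by simp) μ, sub_add_cancel]

/-! ### The weighted Brion theorem for degenerations -/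

theorem realVec_add {d : ℕ} (a u : Fin d → ℤ) : realVec (a + u) = realVec a + realVec u := by
  funext i
  simp [realVec]

section Identity

variable {d : ℕ} {R : Type*} [CommRing R]
  {ι : Type*} [Fintype ι] {A : ι → StrongDual ℝ (Fin d → ℝ)} {b : ι → ℝ}
  {κ : Type*} {A' : κ → StrongDual ℝ (Fin d → ℝ)} {b' : κ → ℝ}
  {π : Face (polyhedron A b) → Face (polyhedron A' b')}

theorem coe_neg_one_zpow_sub (m n : ℕ) :
    (((-1 : ℤˣ) ^ ((m : ℤ) - (n : ℤ)) : ℤˣ) : ℤ) = (-1) ^ m * (-1) ^ n := by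
  rw [zpow_sub, zpow_natCast, zpow_natCast]
  rcases neg_one_pow_eq_or ℤˣ n with h | h <;> rcases neg_one_pow_eq_or ℤ n with h' | h' <;>
    simp_all [Units.ext_iff]

open Classical in
-- After expanding `φ` in `μ` and exchanging sums, the coefficient of `μ f` is the signed fibre sum
-- of `sum_fiber`; for `f'` outside `π f` the fibre is empty by monotonicity of `π`.
theorem pushWeight_eq_sum [Fintype κ] [Fintype (Face (polyhedron A b))]
    (hπ : IsInducedFaceMap π) (h : IsFanLimit (polyhedron A b) (polyhedron A' b'))
    {φ μ : Face (polyhedron A b) → R}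
    (hμ : ∀ g, φ g = ∑ f : Face (polyhedron A b) with g.1 ⊆ f.1, μ f)
    (f' : Face (polyhedron A' b')) :
    pushWeight π φ f' = ∑ f, if f'.1 ⊆ (π f).1 then μ f else 0 := by
  have h1 : pushWeight π φ f' =
      ∑ g with π g = f', ((-1 : ℤ) ^ g.dim * (-1) ^ f'.dim) • φ g := by
    rw [pushWeight, Finset.sum_filter, finsum_eq_sum_of_fintype]
    refine Finset.sum_congr rfl fun g _ => ?_
    rw [finsum_eq_if, coe_neg_one_zpow_sub]
  have h2 : ∀ f : Face (polyhedron A b),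
      ∑ g with g.1 ⊆ f.1 ∧ π g = f', (-1 : ℤ) ^ g.dim * (-1) ^ f'.dim =
        if f'.1 ⊆ (π f).1 then 1 else 0 := by
    intro f
    split_ifs with hf
    · rw [← Finset.sum_mul, hπ.sum_fiber h f hf, ← mul_pow]
      simp
    · refine Finset.sum_eq_zero fun g hg => ?_
      obtain ⟨hgf, rfl⟩ := (Finset.mem_filter.1 hg).2
      exact absurd (hπ.mono hgf) hf
  have h3 : ∀ f : Face (polyhedron A b), (if f'.1 ⊆ (π f).1 then μ f else 0) =
      ∑ g with g.1 ⊆ f.1 ∧ π g = f', ((-1 : ℤ) ^ g.dim * (-1) ^ f'.dim) • μ f := fun f => by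
    rw [← Finset.sum_smul, h2, ite_smul, one_smul, zero_smul]
  rw [h1, Finset.sum_congr rfl fun f _ => h3 f]
  simp only [hμ, Finset.smul_sum, Finset.sum_filter]
  rw [Finset.sum_comm]
  refine Finset.sum_congr rfl fun g _ => ?_
  by_cases hg : π g = f' <;> simp [hg]

open Classical in
theorem weightedSeries_pushWeight [Fintype κ] [Fintype (Face (polyhedron A b))]
    (hπ : IsInducedFaceMap π) (h : IsFanLimit (polyhedron A b) (polyhedron A' b'))
    {φ μ : Face (polyhedron A b) → R}
    (hμ : ∀ g, φ g = ∑ f : Face (polyhedron A b) with g.1 ⊆ f.1, μ f) (a : Fin d → ℤ) :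
    weightedSeries (polyhedron A' b') (pushWeight π φ) a =
      ∑ f, if realVec a ∈ (π f).1 then μ f else 0 := by
  by_cases ha : realVec a ∈ polyhedron A' b'
  · obtain ⟨f', hf', -⟩ := exists_isMinFace ha
    rw [weightedSeries_eq_of_isMinFace hf', pushWeight_eq_sum hπ h hμ]
    refine Finset.sum_congr rfl fun f _ => if_congr ⟨fun hf => hf hf'.1, hf'.2 _⟩ rfl rfl
  · rw [weightedSeries_eq_zero ha]
    exact (Finset.sum_eq_zero fun f _ => if_neg fun hf => ha ((π f).subset hf)).symm

open Classical in
-- At a vertex, `shiftedCone π f v.face` is the tangent cone moved by `w` and cut by the equations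
-- of `f`.
theorem weightedSeries_tangentCone [Fintype (Face (polyhedron A b))]
    {φ μ : Face (polyhedron A b) → R}
    (hμ : ∀ g, φ g = ∑ f : Face (polyhedron A b) with g.1 ⊆ f.1, μ f)
    (v : Vertex (polyhedron A b)) {w : Fin d → ℤ} (hw : (π v.face).1 = {v.1 + realVec w})
    (a : Fin d → ℤ) :
    weightedSeries (tangentCone (polyhedron A b) v.1) (restrictWeight φ v) (a - w) =
      ∑ f with v.face.1 ⊆ f.1, if realVec a ∈ shiftedCone π f v.face then μ f else 0 := by
  have hvf : ∀ f : Face (polyhedron A b), v.face.1 ⊆ f.1 ↔ v.1 ∈ f.1 := fun f =>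
    Set.singleton_subset_iff
  have ha : realVec a = realVec (a - w) + realVec w := by rw [← realVec_add, sub_add_cancel]
  have hshift : ∀ f, realVec a ∈ shiftedCone π f v.face ↔
      realVec (a - w) ∈ tangentCone (polyhedron A b) v.1 ∧
        ∀ l ∈ normalCone f, l (realVec (a - w)) = l v.1 := by
    intro f
    rw [v.mem_tangentCone_iff, shiftedCone, Set.mem_ofPred_eq, hw, ha]
    simp
  by_cases hC : realVec (a - w) ∈ tangentCone (polyhedron A b) v.1
  · obtain ⟨g, hg⟩ := exists_isMinFace_of_eq (tangentCone_polyhedron v.mem) hC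
    rw [weightedSeries_eq_of_isMinFace hg, restrictWeight, hμ, Finset.sum_filter,
      Finset.sum_filter]
    refine Finset.sum_congr rfl fun f _ => ?_
    rw [← ite_and]
    refine if_congr ?_ rfl rfl
    rw [coneFace_subset_iff v hg, hshift, hvf]
    simp [hC]
  · rw [weightedSeries_eq_zero hC]
    exact (Finset.sum_eq_zero fun f _ => if_neg fun hf => hC ((hshift f).1 hf).1).symm

/-- All conditions on `x` use functionals of the normal cone of `g`, which vanish on the direction
of `g`. -/
theorem shiftedCone_add_mem_iff {P Q : Set (Fin d → ℝ)} {π : Face P → Face Q} {f g : Face P}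
    (hgf : g.1 ⊆ f.1) {u : Fin d → ℝ} (hu : u ∈ vectorSpan ℝ g.1) (x : Fin d → ℝ) :
    x + u ∈ shiftedCone π f g ↔ x ∈ shiftedCone π f g := by
  have h : ∀ l ∈ normalCone g, l (x + u) = l x := fun l hl => by
    rw [map_add, normalCone_apply_vectorSpan hl hu, add_zero]
  refine and_congr (forall₂_congr fun l hl => ?_) (forall₂_congr fun l hl => ?_)
  · rw [h l hl]
  · rw [h l (normalCone_antitone hgf hl)]

open Classical in
/-- The contribution of the face `g` to the Brianchon-Gram decomposition. -/
def faceSeries [Fintype (Face (polyhedron A b))]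
    (π : Face (polyhedron A b) → Face (polyhedron A' b'))
    (μ : Face (polyhedron A b) → R) (g : Face (polyhedron A b)) : (Fin d → ℤ) → R :=
  fun a => ∑ f with g.1 ⊆ f.1, if realVec a ∈ shiftedCone π f g then (-1) ^ g.dim * μ f else 0

open Classical in
theorem weightedSeries_eq_sum_faceSeries [Fintype κ] [Fintype (Face (polyhedron A b))]
    (hπ : IsInducedFaceMap π) (h : IsFanLimit (polyhedron A b) (polyhedron A' b'))
    (hΩ : (interior (fanSupport (polyhedron A b))).Nonempty) {φ μ : Face (polyhedron A b) → R}
    (hμ : ∀ g, φ g = ∑ f : Face (polyhedron A b) with g.1 ⊆ f.1, μ f) :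
    weightedSeries (polyhedron A' b') (pushWeight π φ) =
      ∑ g with cell g ⊆ interior (fanSupport (polyhedron A b)), faceSeries π μ g := by
  funext a
  rw [weightedSeries_pushWeight hπ h hμ, Finset.sum_apply]
  have h1 : ∀ f : Face (polyhedron A b), (if realVec a ∈ (π f).1 then μ f else 0) =
      ∑ g with g.1 ⊆ f.1 ∧ cell g ⊆ interior (fanSupport (polyhedron A b)),
        if realVec a ∈ shiftedCone π f g then (-1) ^ g.dim * μ f else 0 := by
    intro f
    have := congrArg (Int.cast (R := R)) (hπ.sum_shiftedCone h hΩ f (realVec a))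
    push_cast at this
    have := congrArg (· * μ f) this
    simp only [Finset.sum_mul, ite_mul, zero_mul, one_mul] at this
    exact this.symm
  rw [Finset.sum_congr rfl fun f _ => h1 f]
  simp only [faceSeries, Finset.sum_filter]
  rw [Finset.sum_comm]
  refine Finset.sum_congr rfl fun g _ => ?_
  by_cases hg : cell g ⊆ interior (fanSupport (polyhedron A b)) <;> simp [hg]

open Classical in
theorem hasSumRat_pushWeight_of_vertex [Fintype κ] [Fintype (Face (polyhedron A b))]
    (hπ : IsInducedFaceMap π) (h : IsFanLimit (polyhedron A b) (polyhedron A' b'))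
    (v₀ : Vertex (polyhedron A b)) {φ : Face (polyhedron A b) → R}
    {w : Vertex (polyhedron A b) → (Fin d → ℤ)}
    (hw : ∀ v, (π v.face).1 = {v.1 + realVec (w v)})
    {r : Vertex (polyhedron A b) → RatFun R d}
    (hcone : ∀ v, HasSumRat (weightedSeries (tangentCone (polyhedron A b) v.1)
      (restrictWeight φ v)) (r v))
    (hface : ∀ (μ : Face (polyhedron A b) → R) (g : Face (polyhedron A b)), g.dim ≠ 0 →
      HasSumRat (faceSeries π μ g) 0) :
    HasSumRat (weightedSeries (polyhedron A' b') (pushWeight π φ))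
      (∑ᶠ v, expMonomial R (w v) * r v) := by
  have : Finite (Vertex (polyhedron A b)) := Finite.of_injective _ Vertex.face_injective
  let _ := Fintype.ofFinite (Vertex (polyhedron A b))
  obtain ⟨μ, hμ⟩ := exists_sum_superset (fun f : Face (polyhedron A b) => f.1)
    Subtype.val_injective φ
  have hΩ := (cell_nonempty v₀.face).mono (cell_vertex_subset_interior v₀)
  -- All vertices occur among the faces in the Brianchon-Gram sum, and they are exactly its members
  -- of dimension zero.
  have himg : (Finset.univ.filter fun g : Face (polyhedron A b) =>
      cell g ⊆ interior (fanSupport (polyhedron A b))).filter (fun g => g.dim = 0) =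
      Finset.univ.image Vertex.face := by
    ext g
    simp only [Finset.mem_filter, Finset.mem_univ, true_and, Finset.mem_image]
    constructor
    · rintro ⟨-, hg⟩
      exact Face.exists_vertex_of_dim_eq_zero hg
    · rintro ⟨v, rfl⟩
      exact ⟨cell_vertex_subset_interior v, v.dim_face⟩
  rw [weightedSeries_eq_sum_faceSeries hπ h hΩ hμ, finsum_eq_sum_of_fintype,
    ← Finset.sum_filter_add_sum_filter_not _ fun g => g.dim = 0,
    ← add_zero (∑ v, expMonomial R (w v) * r v)]
  refine HasSumRat.add ?_ ?_
  · rw [himg, Finset.sum_image fun v _ v' _ h => Vertex.face_injective h]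
    refine HasSumRat.sum _ fun v _ => ?_
    have hs : faceSeries π μ v.face = fun a =>
        weightedSeries (tangentCone (polyhedron A b) v.1) (restrictWeight φ v) (a - w v) := by
      funext a
      rw [weightedSeries_tangentCone hμ v (hw v), faceSeries]
      simp [v.dim_face]
    rw [hs]
    exact (hcone v).shift (w v)
  · have := HasSumRat.sum (r := fun _ => 0) (Finset.filter (fun g => ¬ g.dim = 0)
      (Finset.univ.filter fun g : Face (polyhedron A b) =>
        cell g ⊆ interior (fanSupport (polyhedron A b))))
      fun g hg => hface μ g (Finset.mem_filter.1 hg).2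
    rwa [Finset.sum_const_zero] at this

end Identity

section Rational

variable {d : ℕ} {R : Type*} [CommRing R]

theorem hasSumRat_weightedIPT {P : Set (Fin d → ℝ)} {φ : Face P → R}
    (h : IsRatSeries (weightedSeries P φ)) : HasSumRat (weightedSeries P φ) (weightedIPT P φ) := by
  obtain ⟨r, hr⟩ := h.exists_hasSumRat
  rw [weightedIPT, hr.sumRat_eq]
  exact hr

variable {m : ℕ} {A : Fin m → Fin d → ℤ} {b : Fin m → ℤ}

theorem isRatSeries_weightedSeries_of_eq {ι : Type*} [Fintype ι] {B : ι → Fin d → ℤ} {c : ι → ℤ}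
    {P : Set (Fin d → ℝ)} (hP : P = polyhedron (fun i => intForm (B i)) fun i => (c i : ℝ))
    (φ : Face P → R) : IsRatSeries (weightedSeries P φ) := by
  subst hP
  exact isRatSeries_weightedSeries φ

open Classical in
theorem hasSumRat_weightedIPT_tangentCone
    (v : Vertex (polyhedron (fun i => intForm (A i)) fun i => (b i : ℝ)))
    (φ : Face (tangentCone (polyhedron (fun i => intForm (A i)) fun i => (b i : ℝ)) v.1) → R) :
    HasSumRat (weightedSeries _ φ) (weightedIPT _ φ) :=
  hasSumRat_weightedIPT <| isRatSeries_weightedSeries_of_eq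
    (B := fun i : {i // intForm (A i) v.1 = b i} => A i) (c := fun i => b i)
    (tangentCone_polyhedron v.mem) φ

variable {κ : Type*} {A' : κ → StrongDual ℝ (Fin d → ℝ)} {b' : κ → ℝ}

open Classical in
theorem hasSumRat_faceSeries_zero
    [Fintype (Face (polyhedron (fun i => intForm (A i)) fun i => (b i : ℝ)))]
    (π : Face (polyhedron (fun i => intForm (A i)) fun i => (b i : ℝ)) →
      Face (polyhedron A' b'))
    (μ : Face (polyhedron (fun i => intForm (A i)) fun i => (b i : ℝ)) → R)
    {g : Face (polyhedron (fun i => intForm (A i)) fun i => (b i : ℝ))} (hg : g.dim ≠ 0) :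
    HasSumRat (faceSeries π μ g) 0 := by
  obtain ⟨u, hu, hmem⟩ := g.exists_int_mem_vectorSpan hg
  refine hasSumRat_zero_of_periodic hu fun a => Finset.sum_congr rfl fun f hf => ?_
  rw [realVec_add]
  exact if_congr (shiftedCone_add_mem_iff (Finset.mem_filter.1 hf).2 hmem _) rfl rfl

/-- If `P` has no vertices, all series on its degenerations represent zero. -/
theorem hasSumRat_zero_of_isEmpty_vertex [Fintype κ]
    (h : IsFanLimit (polyhedron (fun i => intForm (A i)) fun i => (b i : ℝ)) (polyhedron A' b'))
    (hv : IsEmpty (Vertex (polyhedron (fun i => intForm (A i)) fun i => (b i : ℝ))))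
    (ψ : Face (polyhedron A' b') → R) : HasSumRat (weightedSeries _ ψ) 0 := by
  by_cases hne : (polyhedron A' b').Nonempty
  swap
  · rw [show weightedSeries (polyhedron A' b') ψ = 0 from
      funext fun a => weightedSeries_eq_zero fun ha => hne ⟨_, ha⟩]
    exact hasSumRat_zero
  have hPne := h.nonempty_iff.2 hne
  -- Without vertices `P` contains a line, and then one with an integer direction `u`. Every
  -- functional bounded above on `P`, equivalently on `Q`, vanishes on `u`, so `Q` and its faces are
  -- `u`-periodic.
  obtain ⟨z, hz, hz0⟩ : ∃ z : Fin d → ℝ, (∀ i, intForm (A i) z = 0) ∧ z ≠ 0 := by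
    by_contra! hcon
    exact not_isEmpty_iff.2 (exists_vertex hPne hcon) hv
  obtain ⟨u, hu, hAu⟩ := exists_int_ne_zero_of_real A hz0 hz
  have hsupp := h.fanSupport_eq isPolyhedron_polyhedron hne
  have hl : ∀ l ∈ fanSupport (polyhedron A' b'), l (realVec u) = 0 := by
    rw [← hsupp]
    rintro l ⟨x, hx, hmax⟩
    have h1 := hmax (x + realVec u) fun i => by
      rw [map_add, hAu, add_zero]
      exact hx i
    have h2 := hmax (x - realVec u) fun i => by
      rw [map_sub, hAu, sub_zero]
      exact hx i
    rw [map_add] at h1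
    rw [map_sub] at h2
    linarith
  have hQ : ∀ x, x + realVec u ∈ polyhedron A' b' ↔ x ∈ polyhedron A' b' := fun x =>
    forall_congr' fun i => by rw [map_add, hl _ (coeff_mem_fanSupport hne i), add_zero]
  refine hasSumRat_zero_of_periodic hu fun a => weightedSeries_congr fun f => ?_
  obtain ⟨l, hlf⟩ := cell_nonempty f
  have hlf' : l.toExposed (polyhedron A' b') = f.1 := hlf
  rw [← hlf', realVec_add]
  refine and_congr (hQ _) (forall₂_congr fun y _ => ?_)
  rw [map_add, hl l (cell_subset_fanSupport f hlf), add_zero]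

theorem hasSumRat_pushWeight [Fintype κ]
    (h : IsFanLimit (polyhedron (fun i => intForm (A i)) fun i => (b i : ℝ)) (polyhedron A' b'))
    {π : Face (polyhedron (fun i => intForm (A i)) fun i => (b i : ℝ)) →
      Face (polyhedron A' b')} (hπ : IsInducedFaceMap π)
    (φ : Face (polyhedron (fun i => intForm (A i)) fun i => (b i : ℝ)) → R)
    {w : Vertex (polyhedron (fun i => intForm (A i)) fun i => (b i : ℝ)) → (Fin d → ℤ)}
    (hw : ∀ v, (π v.face).1 = {v.1 + realVec (w v)}) :
    HasSumRat (weightedSeries _ (pushWeight π φ))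
      (∑ᶠ v, expMonomial R (w v) * weightedIPT _ (restrictWeight φ v)) := by
  rcases isEmpty_or_nonempty
    (Vertex (polyhedron (fun i => intForm (A i)) fun i => (b i : ℝ))) with hv | ⟨⟨v₀⟩⟩
  · rw [finsum_of_isEmpty]
    exact hasSumRat_zero_of_isEmpty_vertex h hv _
  have : Finite (Face (polyhedron (fun i => intForm (A i)) fun i => (b i : ℝ))) := finite_face
  let _ := Fintype.ofFinite (Face (polyhedron (fun i => intForm (A i)) fun i => (b i : ℝ)))
  exact hasSumRat_pushWeight_of_vertex hπ h v₀ hw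
    (fun v => hasSumRat_weightedIPT_tangentCone v _)
    fun μ g hg => hasSumRat_faceSeries_zero π μ hg

end Rational

end WeightedBrion

end

theorem lemma3 {d : ℕ} {R : Type*} [CommRing R] (P Q : Set (Fin d → ℝ))
    (hP : WeightedBrion.IsRationalPolyhedron P) (hQ : WeightedBrion.IsRationalPolyhedron Q)
    (hdeg : WeightedBrion.IsDegeneration P Q) (φ : WeightedBrion.Face P → R) :
    (∃! π : WeightedBrion.Face P → WeightedBrion.Face Q, WeightedBrion.IsInducedFaceMap π) ∧
    ∀ π : WeightedBrion.Face P → WeightedBrion.Face Q, WeightedBrion.IsInducedFaceMap π →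
      (∀ v : WeightedBrion.Vertex P, ∃ v' : WeightedBrion.Vertex Q, π v.face = v'.face) ∧
      ∀ w : WeightedBrion.Vertex P → (Fin d → ℤ),
        (∀ v, (π v.face).1 = {v.1 + fun i => (w v i : ℝ)}) →
        (∀ v, WeightedBrion.HasSumRat
          (WeightedBrion.weightedSeries (WeightedBrion.tangentCone P v.1)
            (WeightedBrion.restrictWeight φ v))
          (WeightedBrion.weightedIPT (WeightedBrion.tangentCone P v.1)
            (WeightedBrion.restrictWeight φ v))) ∧
        WeightedBrion.HasSumRat
          (WeightedBrion.weightedSeries Q (WeightedBrion.pushWeight π φ))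
          (WeightedBrion.weightedIPT Q (WeightedBrion.pushWeight π φ)) ∧
        WeightedBrion.weightedIPT Q (WeightedBrion.pushWeight π φ) =
          ∑ᶠ v : WeightedBrion.Vertex P,
            WeightedBrion.expMonomial R (w v) *
              WeightedBrion.weightedIPT (WeightedBrion.tangentCone P v.1)
                (WeightedBrion.restrictWeight φ v) := by
  have hlim := hdeg.isFanLimit
  obtain ⟨m, A, b, rfl⟩ := hP.exists_eq_polyhedron
  obtain ⟨m', A', b', rfl⟩ := hQ.exists_eq_polyhedron
  obtain ⟨π₀, hπ₀⟩ := hlim.exists_isInducedFaceMap WeightedBrion.isPolyhedron_polyhedron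
  refine ⟨⟨π₀, hπ₀, fun π hπ => hπ.unique hπ₀⟩, fun π hπ => ⟨hπ.exists_vertex, fun w hw => ?_⟩⟩
  -- The series represents the right-hand side; uniqueness of the represented rational function
  -- identifies it with `weightedIPT`.
  have h := WeightedBrion.hasSumRat_pushWeight hlim hπ φ hw
  have heq : WeightedBrion.weightedIPT _ (WeightedBrion.pushWeight π φ) = _ := h.sumRat_eq
  exact ⟨fun v => WeightedBrion.hasSumRat_weightedIPT_tangentCone v _, by rwa [heq], heq⟩
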